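/- **Setting.** Work in the $\epsilon$-counterpart of first order arithmetic: terms and formulas are built simultaneously from variables, numerals, symbols for computable functions (including $+,\cdot,\dot-$), decidable relations (including $=,<$), propositional connectives, and $\epsilon$-terms $\epsilon x.F$. A closed $\epsilon$-term is *canonical* if it has no proper closed $\epsilon$-subterm. The rank of an $\epsilon$-term is $1$ plus the largest rank of an $\epsilon$-term in $F$ containing $x$ free ($1$ if there is none); $rk(e)$ is the largest rank of an $\epsilon$-term occurring in the expression $e$ ($0$ if there is none). An *$\epsilon$-substitution* $S$ is a finite function from canonical terms to natural numbers, $rk(S)$ is the maximal rank of a term in its domain ($0$ if it is empty), and $|e|_S$ is the irreducible form of $e$ under $S$: from inside out, closed $\epsilon$-terms are evaluated by $S$ (default value $0$), other closed terms are evaluated to numerals, closed formulas to truth values. Fix a finite sequence $Cr$ of closed $\epsilon$-axioms $F[t]\to \epsilon x.F[x]\not> t\wedge F[\epsilon x.F[x]]$. $S$ is *solving* if all of them are true under $S$. Fix any algorithm assigning to each nonsolving $S$ an axiom $Cr(S)$ of $Cr$ that is false under $S$, where the choice depends only on the values under $S$ of the closed $\epsilon$-terms occurring in $Cr$ (equivalently,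 only on $ind(S)$ below); for $Cr(S)$ as displayed put $e^S=\epsilon x.|F|_S$ and $v^S=|t|_S$. The *H-process* is $S^0=\emptyset$, $S^{n+1}=S^n$ if $S^n$ is solving, and otherwise, with $e=e^{S^n}$, $$S^{n+1}=\{(f,u)\in S^n: rk(f)<rk(e)\}\cup\{(f,u)\in S^n: rk(f)=rk(e),\ f\not\equiv e\}\cup\{(e,v^{S^n})\}.$$ Let $\|0\|=\omega$ and $\|x\|=x-1$ for $x\ge 1$. Enumerate the closed $\epsilon$-terms occurring in $Cr$ as $e_0,\dots,e_{N-1}$ so that $j>i$ whenever $e_j$ is a proper closed subterm of $e_i$, and let $ind(S)=(\omega+1)^{N-1}\|\,|e_{N-1}|_S\|+\dots+(\omega+1)^{0}\|\,|e_0|_S\|$. Put $r_n=rk(S^n)$ and $a_n=ind(S^n)$ if $S^n$ is nonsolving and $r_n=a_n=0$ otherwise; $\mathrm{RANK}=\max\{rk(Cr)+1,2\}$, where $rk(Cr)$ is the largest rank of an axiom in $Cr$. For $m<k$ let $\vec S^{m,k}=(S^n)_{m\le n<k}$, $rk(\vec S^{m,k})=\min(\{r_i:m<i<k\}\cup\{\mathrm{RANK}\})$;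 it is a *section* if $r_m<rk(\vec S^{m,k})$. Let $\mathsf{nd}(\vec S^{m,k})=\{n\in[m,k):r_n\le rk(\vec S^{n,k})\}$. If $r_m\le rk(\vec S^{m,k})$ and $\mathsf{nd}(\vec S^{m,k})=\{k_0<\dots<k_l\}$, $k_{l+1}=k$, the series $\vec S^{k_j,k_{j+1}}$ ($0\le j\le l$) are its components. A series $\vec S^{m,k}$ with $r_m\le rk(\vec S^{m,k})$ is a *$0$-series* if $k=m+1$, and a *$(p+1)$-series* if each of its components is a $p$-series and a section. For $r_m\le rk(\vec S^{m,k})$ and $0\le\xi\le rk(\vec S^{m,k})$ the ordinal $o(\vec S^{m,k};\xi)$ is defined by recursion on $\mathrm{RANK}-\xi$: $o(\vec S^{m,k};\mathrm{RANK})=a_m$; for $\xi<\mathrm{RANK}$, cut $\vec S^{m,k}=\vec S_0*\dots*\vec S_l$ before each term $S^i$ with $m<i<k$ and $r_i=\xi$, and let $o(\vec S^{m,k};\xi)=2^{o(\vec S_0;\xi+1)}+\dots+2^{o(\vec S_l;\xi+1)}$. Put $o(\vec S)=o(\vec S;0)$. **Lemma.** Let $p\in\mathbb N$ and let $\vec S^0=\vec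 S^{m^0,k^0}$ and $\vec S^1=\vec S^{m^1,k^1}$ be two $p$-series in the H-process with $k^0=m^1$, such that $S^{k^1-1}$ is nonsolving and $r_{m^0}\le r_{m^1}$. Then $o(\vec S^1)<o(\vec S^0)<\varepsilon_0$. -/

import Mathlib

open scoped Ordinal

namespace EpsPA

/-! ### The language -/

/-- A language of first order arithmetic: symbols for computable functions, among them `+`, `·` and
cut-off subtraction, and for decidable relations, among them `=` and `<`.  Numerals belong to the
expressions below. -/
structure ArithLang where
  Fn : ℕ → Type
  Rel : ℕ → Type
  fnVal : ∀ {k : ℕ}, Fn k → (Fin k → ℕ) → ℕ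
  relVal : ∀ {k : ℕ}, Rel k → (Fin k → ℕ) → Bool
  fn_computable : ∀ {k : ℕ} (f : Fn k), Computable fun v : List.Vector ℕ k => fnVal f v.get
  rel_computable : ∀ {k : ℕ} (R : Rel k), Computable fun v : List.Vector ℕ k => relVal R v.get
  add : Fn 2
  mul : Fn 2
  monus : Fn 2
  eq : Rel 2
  lt : Rel 2
  add_val : ∀ v : Fin 2 → ℕ, fnVal add v = v 0 + v 1
  mul_val : ∀ v : Fin 2 → ℕ, fnVal mul v = v 0 * v 1
  monus_val : ∀ v : Fin 2 → ℕ, fnVal monus v = v 0 - v 1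
  eq_val : ∀ v : Fin 2 → ℕ, relVal eq v = decide (v 0 = v 1)
  lt_val : ∀ v : Fin 2 → ℕ, relVal lt v = decide (v 0 < v 1)

/-- The two kinds of expressions. -/
inductive Kind
  | term
  | formula

/-- Binary connectives. -/
inductive Conn
  | and
  | or
  | imp

/-- The truth function of a connective. -/
def Conn.val : Conn → Bool → Bool → Bool
  | .and, a, b => a && b
  | .or, a, b => a || b
  | .imp, a, b => !a || b

/-- Expressions (terms and formulas) of the epsilon counterpart of arithmetic.  Bound variables are
de Bruijn indices: `eps F` is `εx. F[x]`, where `x` is variable `0` of `F` and variable `i + 1` of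
`F` is variable `i` outside.  `num n` is the `n`-th numeral, `truth b` is `⊤` or `⊥`. -/
inductive Exp (L : ArithLang) : Kind → Type
  | var (i : ℕ) : Exp L .term
  | num (n : ℕ) : Exp L .term
  | fn {k : ℕ} (f : L.Fn k) (ts : Fin k → Exp L .term) : Exp L .term
  | eps (F : Exp L .formula) : Exp L .term
  | truth (b : Bool) : Exp L .formula
  | rel {k : ℕ} (R : L.Rel k) (ts : Fin k → Exp L .term) : Exp L .formula
  | neg (A : Exp L .formula) : Exp L .formula
  | conn (c : Conn) (A B : Exp L .formula) : Exp L .formula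

namespace Exp

variable {L : ArithLang}

/-- Variable `i` occurs free in the expression. -/
def HasVar : {κ : Kind} → Exp L κ → ℕ → Prop
  | _, var j, i => j = i
  | _, num _, _ => False
  | _, fn _ ts, i => ∃ j, (ts j).HasVar i
  | _, eps F, i => F.HasVar (i + 1)
  | _, truth _, _ => False
  | _, rel _ ts, i => ∃ j, (ts j).HasVar i
  | _, neg A, i => A.HasVar i
  | _, conn _ A B, i => A.HasVar i ∨ B.HasVar i

/-- No variable occurs free. -/
def Closed {κ : Kind} (e : Exp L κ) : Prop := ∀ i, ¬ e.HasVar i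

/-- `inst t e i`: replace variable `i` of `e` by the closed term `t` (the variables above `i` move
down; `t` is closed, so it need not be shifted under `ε`).  `inst t F 0` is `F[t]`. -/
def inst (t : Exp L .term) : {κ : Kind} → Exp L κ → ℕ → Exp L κ
  | _, var j, i => if j = i then t else if i < j then var (j - 1) else var j
  | _, num n, _ => num n
  | _, fn f ts, i => fn f fun j => inst t (ts j) i
  | _, eps F, i => eps (inst t F (i + 1))
  | _, truth b, _ => truth b
  | _, rel R ts, i => rel R fun j => inst t (ts j) i
  | _, neg A, i => neg (inst t A i)
  | _, conn c A B, i => conn c (inst t A i) (inst t B i)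

open Classical in
/-- The set of the closed epsilon terms that occur in an expression (itself included). -/
noncomputable def closedEps : {κ : Kind} → Exp L κ → Finset (Exp L .term)
  | _, var _ => ∅
  | _, num _ => ∅
  | _, fn _ ts => Finset.univ.biUnion fun j => (ts j).closedEps
  | _, eps F => F.closedEps ∪ if (eps F).Closed then {eps F} else ∅
  | _, truth _ => ∅
  | _, rel _ ts => Finset.univ.biUnion fun j => (ts j).closedEps
  | _, neg A => A.closedEps
  | _, conn _ A B => A.closedEps ∪ B.closedEps

/-- A canonical term: a closed epsilon term without a proper closed epsilon subterm. -/
def Canonical (e : Exp L .term) : Prop :=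
  ∃ F : Exp L .formula, e = eps F ∧ e.Closed ∧ F.closedEps = ∅

open Classical in
/-- `e.subRank i` is the greatest rank of an epsilon term in `e` in which variable `i` occurs free
(`0` if there is none); the rank of `εx. F` is one more than the greatest rank of an epsilon term
in `F` in which `x` occurs free. -/
noncomputable def subRank : {κ : Kind} → Exp L κ → ℕ → ℕ
  | _, var _, _ => 0
  | _, num _, _ => 0
  | _, fn _ ts, i => Finset.univ.sup fun j => (ts j).subRank i
  | _, eps F, i => max (if F.HasVar (i + 1) then F.subRank 0 + 1 else 0) (F.subRank (i + 1))
  | _, truth _, _ => 0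
  | _, rel _ ts, i => Finset.univ.sup fun j => (ts j).subRank i
  | _, neg A, i => A.subRank i
  | _, conn _ A B, i => max (A.subRank i) (B.subRank i)

/-- The rank of an expression: the greatest rank of an epsilon term that occurs in it (itself
included), `0` if there is none. -/
noncomputable def rank : {κ : Kind} → Exp L κ → ℕ
  | _, var _ => 0
  | _, num _ => 0
  | _, fn _ ts => Finset.univ.sup fun j => (ts j).rank
  | _, eps F => max (F.subRank 0 + 1) F.rank
  | _, truth _ => 0
  | _, rel _ ts => Finset.univ.sup fun j => (ts j).rank
  | _, neg A => A.rank
  | _, conn _ A B => max A.rank B.rank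

/-- The term is a numeral. -/
def IsNum (t : Exp L .term) : Prop := ∃ n, t = num n

/-- The formula is a truth value. -/
def IsTruth (A : Exp L .formula) : Prop := ∃ b, A = truth b

/-- The number denoted by a numeral (`0` for other terms). -/
def toNat : Exp L .term → ℕ
  | num n => n
  | _ => 0

/-- The truth value that a formula is (`false` for other formulas). -/
def toBool : Exp L .formula → Bool
  | truth b => b
  | _ => false

open Classical in
/-- The irreducible form of `e` when the closed epsilon terms whose proper subterms are already
reduced take the values `s`: every closed term is reduced to a numeral and every closed formula to
a truth value, from inside out. -/
noncomputable def reduce (s : Exp L .term → ℕ) : {κ : Kind} → Exp L κ → Exp L κ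
  | _, var i => var i
  | _, num n => num n
  | _, fn f ts =>
      if ∀ j, (reduce s (ts j)).IsNum then num (L.fnVal f fun j => (reduce s (ts j)).toNat)
      else fn f fun j => reduce s (ts j)
  | _, eps F =>
      if (eps (reduce s F)).Closed then num (s (eps (reduce s F))) else eps (reduce s F)
  | _, truth b => truth b
  | _, rel R ts =>
      if ∀ j, (reduce s (ts j)).IsNum then truth (L.relVal R fun j => (reduce s (ts j)).toNat)
      else rel R fun j => reduce s (ts j)
  | _, neg A =>
      if (reduce s A).IsTruth then truth (!(reduce s A).toBool) else neg (reduce s A)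
  | _, conn c A B =>
      if (reduce s A).IsTruth ∧ (reduce s B).IsTruth then
        truth (c.val (reduce s A).toBool (reduce s B).toBool)
      else conn c (reduce s A) (reduce s B)

theorem IsNum.not_hasVar {t : Exp L .term} (h : t.IsNum) (i : ℕ) : ¬ t.HasVar i := by
  obtain ⟨n, rfl⟩ := h
  simp [HasVar]

theorem IsTruth.not_hasVar {A : Exp L .formula} (h : A.IsTruth) (i : ℕ) : ¬ A.HasVar i := by
  obtain ⟨n, rfl⟩ := h
  simp [HasVar]

theorem hasVar_reduce (s : Exp L .term → ℕ) {κ : Kind} (e : Exp L κ) :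
    ∀ i, (reduce s e).HasVar i ↔ e.HasVar i := by
  induction e with
  | var j => intro i; simp [reduce]
  | num n => intro i; simp [reduce]
  | fn f ts ih =>
    intro i
    rw [reduce]
    split_ifs with h
    · have : ∀ j, ¬ (ts j).HasVar i := fun j hj => (h j).not_hasVar i ((ih j i).2 hj)
      simp [HasVar, this]
    · simp [HasVar, ih]
  | eps F ih =>
    intro i
    rw [reduce]
    split_ifs with h
    · have h' := h i
      simp only [HasVar, ih] at h' ⊢
      simp [h']
    · simp [HasVar, ih]
  | truth b => intro i; simp [reduce]
  | rel R ts ih =>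
    intro i
    rw [reduce]
    split_ifs with h
    · have : ∀ j, ¬ (ts j).HasVar i := fun j hj => (h j).not_hasVar i ((ih j i).2 hj)
      simp [HasVar, this]
    · simp [HasVar, ih]
  | neg A ih =>
    intro i
    rw [reduce]
    split_ifs with h
    · have : ¬ A.HasVar i := fun hj => h.not_hasVar i ((ih i).2 hj)
      simp [HasVar, this]
    · simp [HasVar, ih]
  | conn c A B ihA ihB =>
    intro i
    rw [reduce]
    split_ifs with h
    · have hA : ¬ A.HasVar i := fun hj => h.1.not_hasVar i ((ihA i).2 hj)
      have hB : ¬ B.HasVar i := fun hj => h.2.not_hasVar i ((ihB i).2 hj)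
      simp [HasVar, hA, hB]
    · simp [HasVar, ihA, ihB]

theorem closedEps_reduce (s : Exp L .term → ℕ) {κ : Kind} (e : Exp L κ) :
    (reduce s e).closedEps = ∅ := by
  induction e with
  | var j => simp [reduce, closedEps]
  | num n => simp [reduce, closedEps]
  | fn f ts ih =>
    rw [reduce]
    split_ifs with h <;> ext <;> simp [closedEps, ih]
  | eps F ih =>
    rw [reduce]
    split_ifs with h
    · simp [closedEps]
    · simp [closedEps, ih, h]
  | truth b => simp [reduce, closedEps]
  | rel R ts ih =>
    rw [reduce]
    split_ifs with h <;> ext <;> simp [closedEps, ih]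
  | neg A ih =>
    rw [reduce]
    split_ifs with h <;> ext <;> simp [closedEps, ih]
  | conn c A B ihA ihB =>
    rw [reduce]
    split_ifs with h <;> ext <;> simp [closedEps, ihA, ihB]

theorem canonical_eps_reduce (s : Exp L .term → ℕ) {F : Exp L .formula} (hF : (eps F).Closed) :
    (eps (reduce s F)).Canonical := by
  refine ⟨reduce s F, rfl, fun i => ?_, closedEps_reduce s F⟩
  have := hF i
  simpa [HasVar, hasVar_reduce] using this

end Exp

variable {L : ArithLang}

/-! ### Substitutions, epsilon axioms and the H-process -/

/-- An epsilon substitution: a finite function from canonical terms to numbers; `val` is that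
function extended by the default value `0` outside the domain. -/
structure EpsSub (L : ArithLang) where
  dom : Finset (Exp L .term)
  val : Exp L .term → ℕ
  canonical : ∀ e ∈ dom, e.Canonical
  val_eq_zero : ∀ e, e ∉ dom → val e = 0

/-- The empty substitution. -/
def EpsSub.empty : EpsSub L where
  dom := ∅
  val := fun _ => 0
  canonical := by simp
  val_eq_zero := fun _ _ => rfl

/-- The rank of a substitution. -/
noncomputable def EpsSub.rank (S : EpsSub L) : ℕ := S.dom.sup fun e => e.rank

/-- The numerical value of a closed term under a substitution. -/
noncomputable def EpsSub.value (S : EpsSub L) (t : Exp L .term) : ℕ := (t.reduce S.val).toNat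

/-- The substitution validates the formula. -/
def EpsSub.Validates (S : EpsSub L) (A : Exp L .formula) : Prop := A.reduce S.val = .truth true

/-- The data of a closed epsilon axiom `F[t] → εx. F[x] ≯ t ∧ F[εx. F[x]]`. -/
structure EpsAxiom (L : ArithLang) where
  F : Exp L .formula
  t : Exp L .term
  closed_eps : (Exp.eps F).Closed
  closed_t : t.Closed

/-- The epsilon axiom `F[t] → εx. F[x] ≯ t ∧ F[εx. F[x]]`. -/
def EpsAxiom.formula (A : EpsAxiom L) : Exp L .formula :=
  .conn .imp (Exp.inst A.t A.F 0)
    (.conn .and (.neg (.rel L.lt ![A.t, .eps A.F])) (Exp.inst (.eps A.F) A.F 0))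

/-- All the axioms of `Cr` are valid under `S`. -/
def Solving (Cr : List (EpsAxiom L)) (S : EpsSub L) : Prop :=
  ∀ A ∈ Cr, S.Validates A.formula

open Classical in
/-- The set of the closed epsilon terms that occur in `Cr`. -/
noncomputable def closedTerms (Cr : List (EpsAxiom L)) : Finset (Exp L .term) :=
  Cr.toFinset.biUnion fun A => A.formula.closedEps

/-- `RANK(Cr) = max {rk(Cr) + 1, 2}`. -/
noncomputable def RANK (Cr : List (EpsAxiom L)) : ℕ := by
  classical exact max ((Cr.toFinset.sup fun A => A.formula.rank) + 1) 2

/-- An algorithm that associates with each nonsolving substitution an axiom of `Cr` that is false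
under it.  The choice is made from the values of the closed epsilon terms of `Cr`. -/
structure Selection (Cr : List (EpsAxiom L)) where
  pick : EpsSub L → EpsAxiom L
  pick_mem : ∀ S, ¬ Solving Cr S → pick S ∈ Cr
  pick_false : ∀ S, ¬ Solving Cr S → ¬ S.Validates (pick S).formula
  pick_congr : ∀ S T, ¬ Solving Cr S → ¬ Solving Cr T →
    (∀ e ∈ closedTerms Cr, S.value e = T.value e) → pick S = pick T

/-- The canonical term `εx. |F|_S` that the axiom determines under `S`. -/
noncomputable def EpsAxiom.term (A : EpsAxiom L) (S : EpsSub L) : Exp L .term :=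
  .eps (A.F.reduce S.val)

open Classical in
/-- The correction of `S` by the axiom `A`: with `e = εx. |F|_S` and `v = |t|_S`, keep the entries of
rank `< rk(e)`, those of rank `= rk(e)` other than the one for `e`, and give `e` the value `v`. -/
noncomputable def EpsSub.correct (S : EpsSub L) (A : EpsAxiom L) : EpsSub L where
  dom := insert (A.term S)
    (S.dom.filter fun f =>
      f.rank < (A.term S).rank ∨ f.rank = (A.term S).rank ∧ f ≠ A.term S)
  val := fun f =>
    if f = A.term S then S.value A.t
    else if f ∈ S.dom ∧ f.rank ≤ (A.term S).rank then S.val f else 0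
  canonical := by
    intro e he
    rcases Finset.mem_insert.1 he with rfl | he
    · exact Exp.canonical_eps_reduce S.val A.closed_eps
    · exact S.canonical e (Finset.mem_filter.1 he).1
  val_eq_zero := by
    intro e he
    simp only [Finset.mem_insert, Finset.mem_filter, not_or, not_and] at he
    obtain ⟨h1, h2⟩ := he
    rw [if_neg h1, if_neg]
    rintro ⟨h3, h4⟩
    obtain ⟨h5, h6⟩ := h2 h3
    exact h6 (le_antisymm h4 (not_lt.1 h5)) h1

open Classical in
/-- The H-process for `Cr`. -/
noncomputable def hSeq {Cr : List (EpsAxiom L)} (σ : Selection Cr) : ℕ → EpsSub L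
  | 0 => EpsSub.empty
  | n + 1 =>
      if Solving Cr (hSeq σ n) then hSeq σ n
      else (hSeq σ n).correct (σ.pick (hSeq σ n))

open Classical in
/-- `r_n`: the rank of `S^n` up to a solution, then `0`. -/
noncomputable def rnk {Cr : List (EpsAxiom L)} (σ : Selection Cr) (n : ℕ) : ℕ :=
  if Solving Cr (hSeq σ n) then 0 else (hSeq σ n).rank

/-! ### Indices -/

/-- The order type of `x` in the Ackermann ordering `1, 2, 3, …, 0` of the natural numbers. -/
noncomputable def ackNorm (x : ℕ) : Ordinal.{0} := if x = 0 then ω else ((x - 1 : ℕ) : Ordinal.{0})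

/-- An arrangement `e_0, …, e_{N-1}` of the closed epsilon terms of `Cr` in which every closed
proper subterm `e_j` of `e_i` has `j > i`. -/
structure Arrangement (Cr : List (EpsAxiom L)) where
  equiv : Fin (closedTerms Cr).card ≃ closedTerms Cr
  lt_of_sub : ∀ i j, (equiv j : Exp L .term) ∈ (equiv i : Exp L .term).closedEps →
    (equiv j : Exp L .term) ≠ equiv i → i < j

/-- `(ω+1)^(n-1) · g (n-1) + ⋯ + (ω+1)^0 · g 0`. -/
noncomputable def expansion (g : ℕ → Ordinal.{0}) : ℕ → Ordinal.{0}
  | 0 => 0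
  | n + 1 => (ω + 1) ^ n * g n + expansion g n

/-- The index `ind(S) = ∑ (ω+1)^i · ‖|e_i|_S‖`. -/
noncomputable def ind {Cr : List (EpsAxiom L)} (E : Arrangement Cr) (S : EpsSub L) : Ordinal.{0} :=
  expansion
    (fun i => if h : i < (closedTerms Cr).card then ackNorm (S.value (E.equiv ⟨i, h⟩)) else 0)
    (closedTerms Cr).card

open Classical in
/-- `a_n`: the index of `S^n` up to a solution, then `0`. -/
noncomputable def index {Cr : List (EpsAxiom L)} (σ : Selection Cr) (E : Arrangement Cr) (n : ℕ) :
    Ordinal.{0} :=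
  if Solving Cr (hSeq σ n) then 0 else ind E (hSeq σ n)

/-! ### Series

A consecutive series `S^m, …, S^{k-1}` is given by the pair `m < k`. -/

section Series

variable {Cr : List (EpsAxiom L)} (σ : Selection Cr)

/-- `rk(S^{m,k}) = min ({r_i : m < i < k} ∪ {RANK})`. -/
noncomputable def seriesRank (m k : ℕ) : ℕ := sInf (insert (RANK Cr) (rnk σ '' Set.Ioo m k))

/-- `S^{m,k}` is a section: `r_m < rk(S^{m,k})`. -/
def IsSection (m k : ℕ) : Prop := rnk σ m < seriesRank σ m k

/-- `nd(S^{m,k}) = {n ∈ [m,k) : r_n ≤ rk(S^{n,k})}`. -/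
def nd (m k : ℕ) : Set ℕ := {n | m ≤ n ∧ n < k ∧ rnk σ n ≤ seriesRank σ n k}

/-- `S^{a,b}` is a component in the decomposition of `S^{m,k}`: for `nd(S^{m,k}) = {k_0 < ⋯ < k_l}`
and `k_{l+1} = k`, the numbers `a` and `b` are some `k_j` and `k_{j+1}`. -/
def IsComponent (m k a b : ℕ) : Prop :=
  a ∈ nd σ m k ∧ b ∈ insert k (nd σ m k) ∧ a < b ∧ ∀ c ∈ nd σ m k, ¬ (a < c ∧ c < b)

/-- `S^{m,k}` is a `p`-series. -/
def IsSeries : ℕ → ℕ → ℕ → Prop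
  | 0, m, k => m < k ∧ rnk σ m ≤ seriesRank σ m k ∧ k = m + 1
  | p + 1, m, k => m < k ∧ rnk σ m ≤ seriesRank σ m k ∧
      ∀ a b, IsComponent σ m k a b → IsSeries p a b ∧ IsSection σ a b

/-- The intervals into which `[m,k)` is cut at `m` and at all `i` with `m < i < k` and `r_i = ξ`,
from left to right. -/
noncomputable def pieces (ξ m k : ℕ) : List (ℕ × ℕ) :=
  let cuts := m :: (List.range' (m + 1) (k - (m + 1))).filter (fun i => rnk σ i == ξ)
  cuts.zip (cuts.tail ++ [k])

variable (E : Arrangement Cr)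

/-- `seriesOrdAux σ E d m k` is `o(S^{m,k}; RANK - d)`, see `seriesOrd`. -/
noncomputable def seriesOrdAux : ℕ → ℕ → ℕ → Ordinal.{0}
  | 0, m, _ => index σ E m
  | d + 1, m, k =>
      ((pieces σ (RANK Cr - (d + 1)) m k).map fun I => 2 ^ seriesOrdAux d I.1 I.2).sum

/-- The ordinal `o(S^{m,k}; ξ)` of a series with `r_m ≤ rk(S^{m,k})` and `ξ ≤ rk(S^{m,k})`:
`o(S^{m,k}; RANK) = a_m` (such a series is a singleton), and for `ξ < RANK`
`o(S^{m,k}; ξ) = 2 ^ o(S_0; ξ+1) + ⋯ + 2 ^ o(S_l; ξ+1)`, where `S^{m,k} = S_0 * ⋯ * S_l` is cut at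
the terms of rank `ξ` after the first one.  (For `ξ < rk(S^{m,k})` this is `2 ^ o(S^{m,k}; ξ+1)`.) -/
noncomputable def seriesOrd (ξ m k : ℕ) : Ordinal.{0} := seriesOrdAux σ E (RANK Cr - ξ) m k

end Series

end EpsPA

/-! Of a $p$-series the argument needs only that no later term has rank below that of the first one.
Two things then carry it: the process repeats itself, and sums of powers of 2 with decreasing
exponents compare lexicographically.

Repetition (`exists_dominates`). Let $a=m^1$ and let $x$ be the last place of $\vec S^0$ with
$r_x\le r_a$. Corrections strictly between $x$ and $a$ have rank above $r_a$, so they leave the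
entries of rank at most $r_a$ alone, and the correction leading to $S^a$ deletes what they added.
Hence $S^a$ is $S^x$ with a single value changed, that of the corrected term $e$. As the choice of
axiom sees only the values of the closed terms of $Cr$, the process from $a$ copies the process from
$x$ until one of these values notices the change at $e$. This happens at the latest in the copy of
$S^{a-1}$, because the axiom corrected there evaluates $e$. When it happens, the index is smaller:
the values of $S^n$ are witnesses and $0$ is not (`hSeq_correct`), so the new value of $e$ precedes
the old one in the Ackermann ordering, and `ind_lt_of_update` reads this off the base $\omega+1$
expansion.

Comparison. By induction on $d=\mathrm{RANK}-\xi$ two statements are proved together: a dominated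
series has the smaller ordinal $o(\cdot;\xi)$, and the ordinals of consecutive series with
nondecreasing starting ranks decrease. The second follows from the first at the same level, by
`exists_dominates` and `seriesOrdAux_suffix_le`. At the next level it says that the exponents in
$2^{o(\vec S_0;\xi+1)}+\dots+2^{o(\vec S_l;\xi+1)}$ decrease, so that the sum lies below twice its
first term. Two such sums are therefore compared at the first piece where they differ
(`seriesOrdAux_succ_lt_of_dominates`).

The bound by $\varepsilon_0$ holds because $\varepsilon_0$ is closed under $+$, $\cdot$ and
$2^{(\cdot)}$. -/

namespace EpsPA

/-! ### Ordinal arithmetic -/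

theorem two_opow_lt_of_lt_epsilon_zero {a : Ordinal.{0}} (h : a < ε₀) : (2 : Ordinal.{0}) ^ a < ε₀ := by
  have h1 : ω ^ a < ω ^ (ε₀ : Ordinal.{0}) :=
    (Ordinal.opow_lt_opow_iff_right Ordinal.one_lt_omega0).2 h
  rw [Ordinal.omega0_opow_epsilon] at h1
  exact lt_of_le_of_lt (Ordinal.opow_le_opow_left a (Ordinal.natCast_lt_omega0 2).le) h1

theorem isPrincipal_add_epsilon_zero : Ordinal.IsPrincipal (· + ·) (ε₀ : Ordinal.{0}) := by
  rw [← Ordinal.omega0_opow_epsilon 0]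
  exact Ordinal.isPrincipal_add_omega0_opow _

theorem isPrincipal_mul_epsilon_zero : Ordinal.IsPrincipal (· * ·) (ε₀ : Ordinal.{0}) := by
  have h := Ordinal.isPrincipal_mul_omega0_opow_opow (ε₀ : Ordinal.{0})
  rwa [Ordinal.omega0_opow_epsilon, Ordinal.omega0_opow_epsilon] at h

theorem two_opow_add_self (a : Ordinal.{0}) : (2 : Ordinal.{0}) ^ a + 2 ^ a = 2 ^ Order.succ a := by
  rw [Ordinal.opow_succ, ← one_add_one_eq_two, mul_add, mul_one]

theorem list_sum_lt_epsilon_zero (l : List Ordinal.{0}) (h : ∀ a ∈ l, a < ε₀) : l.sum < ε₀ := by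
  induction l with
  | nil => simp
  | cons a l ih =>
    rw [List.sum_cons]
    exact isPrincipal_add_epsilon_zero (h a (by simp)) (ih fun b hb => h b (by simp [hb]))

theorem expansion_lt {g : ℕ → Ordinal.{0}} (hg : ∀ i, g i ≤ ω) (n : ℕ) :
    expansion g n < (ω + 1) ^ n := by
  induction n with
  | zero => simp [expansion]
  | succ n ih =>
    rw [expansion, pow_succ]
    calc (ω + 1) ^ n * g n + expansion g n
        ≤ (ω + 1) ^ n * ω + expansion g n := by gcongr; exact hg n
      _ < (ω + 1) ^ n * ω + (ω + 1) ^ n := by gcongr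
      _ = (ω + 1) ^ n * (ω + 1) := by rw [mul_add, mul_one]

/-- Positional notation in base $\omega+1$: by `expansion_lt` the digits below place `i` add up to
less than $(\omega+1)^i$, too little to make up for a drop at place `i`. -/
theorem expansion_lt_expansion {g g' : ℕ → Ordinal.{0}} (hg' : ∀ i, g' i ≤ ω) {n i : ℕ} (hi : i < n)
    (hlt : g' i < g i) (heq : ∀ j, i < j → j < n → g' j = g j) :
    expansion g' n < expansion g n := by
  induction n with
  | zero => omega
  | succ n ih =>
    rw [expansion, expansion]
    rcases Nat.lt_succ_iff_lt_or_eq.1 hi with h | rfl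
    · rw [heq n h (Nat.lt_succ_self n)]
      have := ih h fun j hj hjn => heq j hj (by omega)
      gcongr
    · calc (ω + 1) ^ i * g' i + expansion g' i
          < (ω + 1) ^ i * g' i + (ω + 1) ^ i := by gcongr; exact expansion_lt hg' i
        _ = (ω + 1) ^ i * (Order.succ (g' i)) := by rw [Ordinal.mul_succ]
        _ ≤ (ω + 1) ^ i * g i := by gcongr; exact Order.succ_le_of_lt hlt
        _ ≤ _ := le_self_add

theorem expansion_lt_epsilon_zero {g : ℕ → Ordinal.{0}} (hg : ∀ i, g i ≤ ω) (n : ℕ) :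
    expansion g n < ε₀ := by
  refine (expansion_lt hg n).trans ?_
  induction n with
  | zero => simpa using Ordinal.natCast_lt_epsilon 1 0
  | succ n ih =>
    rw [pow_succ]
    refine isPrincipal_mul_epsilon_zero ih ?_
    refine isPrincipal_add_epsilon_zero (Ordinal.omega0_lt_epsilon 0) ?_
    simpa using Ordinal.natCast_lt_epsilon 1 0

theorem ackNorm_le (x : ℕ) : ackNorm x ≤ ω := by
  unfold ackNorm
  split_ifs
  · exact le_rfl
  · exact (Ordinal.natCast_lt_omega0 _).le

/-- The default `0` is last in the Ackermann ordering, so it is an improvement both to replace the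
default by a nonzero value and to replace a value by a smaller nonzero one. -/
theorem ackNorm_lt_of_lt {u v : ℕ} (hv : v ≠ 0) (h : u = 0 ∨ v < u) : ackNorm v < ackNorm u := by
  unfold ackNorm
  rw [if_neg hv]
  split_ifs with hu
  · exact Ordinal.natCast_lt_omega0 _
  · exact_mod_cast (by omega : v - 1 < u - 1)

/-! ### Cutting a series -/

section Series

variable {L : ArithLang} {Cr : List (EpsAxiom L)} (σ : Selection Cr) (E : Arrangement Cr)

/-- `c` is the first place after `m` and before `k` at which the rank is `ξ`. -/
def FirstCut (ξ m k c : ℕ) : Prop :=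
  m < c ∧ c < k ∧ rnk σ c = ξ ∧ ∀ i, m < i → i < c → rnk σ i ≠ ξ

/-- With `seriesOrdAux_of_no_cut` and `seriesOrdAux_of_firstCut`, this distinction lets the
comparisons peel off one piece at a time instead of handling the list of pieces. -/
theorem no_cut_or_firstCut (ξ m k : ℕ) :
    (∀ i, m < i → i < k → rnk σ i ≠ ξ) ∨ ∃ c, FirstCut σ ξ m k c := by
  classical
  by_cases h : ∃ i, m < i ∧ i < k ∧ rnk σ i = ξ
  · right
    obtain ⟨h1, h2, h3⟩ := Nat.find_spec h
    refine ⟨Nat.find h, h1, h2, h3, fun i hi hic hr => ?_⟩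
    exact Nat.find_min h hic ⟨hi, hic.trans h2, hr⟩
  · left
    push Not at h
    exact h

theorem pieces_of_no_cut {ξ m k : ℕ} (h : ∀ i, m < i → i < k → rnk σ i ≠ ξ) :
    pieces σ ξ m k = [(m, k)] := by
  have : (List.range' (m + 1) (k - (m + 1))).filter (fun i => rnk σ i == ξ) = [] := by
    rw [List.filter_eq_nil_iff]
    intro i hi
    rw [List.mem_range'_1] at hi
    simpa using h i (by omega) (by omega)
  simp [pieces, this]

theorem pieces_of_firstCut {ξ m k c : ℕ} (h : FirstCut σ ξ m k c) :
    pieces σ ξ m k = (m, c) :: pieces σ ξ c k := by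
  obtain ⟨h1, h2, h3, h4⟩ := h
  have hnil : (List.range' (m + 1) (c - (m + 1))).filter (fun i => rnk σ i == ξ) = [] := by
    rw [List.filter_eq_nil_iff]
    intro i hi
    rw [List.mem_range'_1] at hi
    simpa using h4 i (by omega) (by omega)
  have hsplit : List.range' (m + 1) (k - (m + 1)) =
      List.range' (m + 1) (c - (m + 1)) ++ c :: List.range' (c + 1) (k - (c + 1)) := by
    have : k - (m + 1) = (c - (m + 1)) + ((k - (c + 1)) + 1) := by omega
    rw [this, ← List.range'_append_1, List.range'_succ]
    have : m + 1 + (c - (m + 1)) = c := by omega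
    rw [this]
  simp [pieces, hsplit, hnil, h3]

theorem seriesOrdAux_of_no_cut {d m k : ℕ}
    (h : ∀ i, m < i → i < k → rnk σ i ≠ RANK Cr - (d + 1)) :
    seriesOrdAux σ E (d + 1) m k = 2 ^ seriesOrdAux σ E d m k := by
  simp [seriesOrdAux, pieces_of_no_cut σ h]

theorem seriesOrdAux_of_firstCut {d m k c : ℕ} (h : FirstCut σ (RANK Cr - (d + 1)) m k c) :
    seriesOrdAux σ E (d + 1) m k =
      2 ^ seriesOrdAux σ E d m c + seriesOrdAux σ E (d + 1) c k := by
  simp [seriesOrdAux, pieces_of_firstCut σ h]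

theorem two_opow_first_le_seriesOrdAux {d m k c : ℕ}
    (h : FirstCut σ (RANK Cr - (d + 1)) m k c) :
    2 ^ seriesOrdAux σ E d m c ≤ seriesOrdAux σ E (d + 1) m k := by
  rw [seriesOrdAux_of_firstCut σ E h]
  exact le_self_add

theorem seriesOrdAux_succ_pos (d m k : ℕ) : 0 < seriesOrdAux σ E (d + 1) m k := by
  rcases no_cut_or_firstCut σ (RANK Cr - (d + 1)) m k with h | ⟨c, h⟩
  · rw [seriesOrdAux_of_no_cut σ E h]
    exact Ordinal.opow_pos _ two_pos
  · exact lt_of_lt_of_le (Ordinal.opow_pos _ two_pos) (two_opow_first_le_seriesOrdAux σ E h)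

theorem seriesOrdAux_lt_epsilon_zero (h : ∀ n, index σ E n < ε₀) (d : ℕ) :
    ∀ m k, seriesOrdAux σ E d m k < ε₀ := by
  induction d with
  | zero => intro m k; exact h m
  | succ d ih =>
    intro m k
    refine list_sum_lt_epsilon_zero _ fun a ha => ?_
    obtain ⟨I, -, rfl⟩ := List.mem_map.1 ha
    exact two_opow_lt_of_lt_epsilon_zero (ih _ _)

/-- The ordinal depends only on the indices and on the ranks after the first term. -/
theorem seriesOrdAux_congr (d : ℕ) : ∀ (n x x' : ℕ), 0 < n →
    (∀ i, 0 < i → i < n → rnk σ (x' + i) = rnk σ (x + i)) →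
    (∀ i, i < n → index σ E (x' + i) = index σ E (x + i)) →
    seriesOrdAux σ E d x' (x' + n) = seriesOrdAux σ E d x (x + n) := by
  induction d with
  | zero => intro n x x' hn _ ha; simpa [seriesOrdAux] using ha 0 hn
  | succ d ihd =>
    intro n
    induction n using Nat.strong_induction_on with
    | _ n ihn =>
      intro x x' hn hr ha
      rcases no_cut_or_firstCut σ (RANK Cr - (d + 1)) x (x + n) with h | ⟨c, h⟩
      · rw [seriesOrdAux_of_no_cut σ E h, seriesOrdAux_of_no_cut σ E, ihd n x x' hn hr ha]
        intro i hi hin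
        obtain ⟨j, rfl⟩ := Nat.exists_eq_add_of_lt hi
        rw [add_assoc, hr (j + 1) (by omega) (by omega)]
        exact h _ (by omega) (by omega)
      · have h' := h
        obtain ⟨h1, h2, h3, h4⟩ := h'
        obtain ⟨j, rfl⟩ : ∃ j, c = x + j := ⟨c - x, by omega⟩
        have hc' : FirstCut σ (RANK Cr - (d + 1)) x' (x' + n) (x' + j) := by
          refine ⟨by omega, by omega, by rw [hr j (by omega) (by omega), h3], fun i hi hij => ?_⟩
          obtain ⟨q, rfl⟩ : ∃ q, i = x' + q := ⟨i - x', by omega⟩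
          rw [hr q (by omega) (by omega)]
          exact h4 _ (by omega) (by omega)
        rw [seriesOrdAux_of_firstCut σ E h, seriesOrdAux_of_firstCut σ E hc',
          ihd j x x' (by omega) (fun i hi hij => hr i hi (by omega))
            (fun i hij => ha i (by omega))]
        have := ihn (n - j) (by omega) (x + j) (x' + j) (by omega)
          (fun i hi hin => by simpa only [add_assoc] using hr (j + i) (by omega) (by omega))
          (fun i hin => by simpa only [add_assoc] using ha (j + i) (by omega))
        have e1 : x + j + (n - j) = x + n := by omega
        have e2 : x' + j + (n - j) = x' + n := by omega
        rw [e1, e2] at this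
        rw [this]

/-- Omitting an initial part of a series does not increase the ordinal. -/
theorem seriesOrdAux_suffix_le (hR : ∀ n, rnk σ n < RANK Cr) (d : ℕ) : ∀ (n m k x : ℕ), k - m ≤ n → m ≤ x → x < k →
    (∀ i, m < i → i < k → RANK Cr - d ≤ rnk σ i) →
    seriesOrdAux σ E d x k ≤ seriesOrdAux σ E d m k := by
  induction d with
  | zero =>
    intro n m k x _ hmx hxk hr
    -- At level $\mathrm{RANK}$ the series is a singleton, as all ranks are below $\mathrm{RANK}$.
    rcases hmx.eq_or_lt with rfl | hlt
    · exact le_rfl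
    · exact absurd (hr x hlt hxk) (by simpa using hR x)
  | succ d ihd =>
    intro n
    induction n with
    | zero => intro m k x h1 h2 h3; omega
    | succ n ihn =>
      intro m k x hn hmx hxk hr
      rcases no_cut_or_firstCut σ (RANK Cr - (d + 1)) m k with h | ⟨c, h⟩
      · rw [seriesOrdAux_of_no_cut σ E h, seriesOrdAux_of_no_cut σ E
          fun i hi hik => h i (by omega) hik]
        refine Ordinal.opow_le_opow_right two_pos (ihd _ m k x le_rfl hmx hxk fun i hi hik => ?_)
        have := hr i hi hik
        have := h i hi hik
        omega
      · have h' := h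
        obtain ⟨h1, h2, h3, h4⟩ := h'
        rw [seriesOrdAux_of_firstCut σ E h]
        -- Beyond the first cut the whole first summand is dropped; before it only the first
        -- exponent is affected.
        rcases le_or_gt c x with hcx | hxc
        · exact (ihn c k x (by omega) hcx hxk fun i hi hik => hr i (by omega) hik).trans
            le_add_self
        · rw [seriesOrdAux_of_firstCut σ E
            (⟨hxc, h2, h3, fun i hi hic => h4 i (by omega) hic⟩ : FirstCut σ _ x k c)]
          gcongr 2 ^ ?_ + _
          refine ihd _ m c x le_rfl hmx hxc fun i hi hic => ?_
          have := hr i hi (by omega)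
          have := h4 i hi hic
          omega

/-- If the ordinals of the consecutive pieces of a series decrease, then the ordinal of the series
is bounded by that of its first piece. -/
theorem seriesOrdAux_lt_two_opow_succ {d y : ℕ}
    (hT : ∀ x c c', c' ≤ y → x < c → c < c' → rnk σ c = RANK Cr - (d + 1) →
      (∀ i, x < i → i < c → RANK Cr - d ≤ rnk σ i) →
      (∀ i, c < i → i < c' → RANK Cr - d ≤ rnk σ i) →
      (rnk σ x ≤ rnk σ c) →
      seriesOrdAux σ E d c c' < seriesOrdAux σ E d x c) :
    ∀ (n x : ℕ), y - x ≤ n → x < y →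
      (∀ i, x < i → i < y → RANK Cr - (d + 1) ≤ rnk σ i) →
      (∀ i, x < i → i < y → rnk σ x ≤ rnk σ i) →
      (∀ c, FirstCut σ (RANK Cr - (d + 1)) x y c →
        seriesOrdAux σ E (d + 1) x y < 2 ^ Order.succ (seriesOrdAux σ E d x c)) ∧
      ((∀ i, x < i → i < y → rnk σ i ≠ RANK Cr - (d + 1)) →
        seriesOrdAux σ E (d + 1) x y < 2 ^ Order.succ (seriesOrdAux σ E d x y)) := by
  have key : ∀ a b : Ordinal.{0}, a < b → (2 : Ordinal.{0}) ^ Order.succ a ≤ 2 ^ b :=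
    fun a b hab => Ordinal.opow_le_opow_right two_pos (Order.succ_le_of_lt hab)
  intro n
  induction n with
  | zero => intro x h1 h2; omega
  | succ n ih =>
    intro x hn hxy hr hx
    constructor
    · intro c h
      have h' := h
      obtain ⟨h1, h2, h3, h4⟩ := h'
      -- It remains to put the rest of the sum below one copy of the first term. Inductively the
      -- rest is below $2^{b+1}$ for the exponent $b$ of the second piece, and `hT` makes $b$
      -- smaller than the first exponent.
      rw [seriesOrdAux_of_firstCut σ E h, ← two_opow_add_self]
      have hrest := ih c (by omega) h2 (fun i hi hiy => hr i (by omega) hiy)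
        (fun i hi hiy => by rw [h3]; exact hr i (by omega) hiy)
      have hfirst : ∀ i, x < i → i < c → RANK Cr - d ≤ rnk σ i := by
        intro i hi hic
        have := hr i hi (by omega)
        have := h4 i hi hic
        omega
      gcongr
      rcases no_cut_or_firstCut σ (RANK Cr - (d + 1)) c y with hnc | ⟨c', hc'⟩
      · refine (hrest.2 hnc).trans_le (key _ _ (hT x c y le_rfl h1 h2 h3 hfirst ?_ (hx c h1 h2)))
        intro i hi hiy
        have := hr i (by omega) hiy
        have := hnc i hi hiy
        omega
      · refine (hrest.1 c' hc').trans_le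
          (key _ _ (hT x c c' hc'.2.1.le h1 hc'.1 h3 hfirst ?_ (hx c h1 h2)))
        intro i hi hic
        have := hr i (by omega) (hic.trans hc'.2.1)
        have := hc'.2.2.2 i hi hic
        omega
    · intro h
      rw [seriesOrdAux_of_no_cut σ E h]
      exact (Ordinal.opow_lt_opow_iff_right one_lt_two).2 (Order.lt_succ _)

end Series

/-! ### Comparison of the ordinals of two series -/

section Series

variable {L : ArithLang} {Cr : List (EpsAxiom L)} (σ : Selection Cr) (E : Arrangement Cr)

/-- The terms of `S^{x',y'}` and `S^{x,y}` have the same ranks and indices up to a place `x + j` in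
the second series, where the first series is over or has the smaller index. -/
structure Dominates (x y x' y' j : ℕ) : Prop where
  lt : x + j < y
  lt' : x' < y'
  rnk_eq : ∀ i, 0 < i → i ≤ j → x' + i < y' → rnk σ (x' + i) = rnk σ (x + i)
  index_eq : ∀ i, i < j → x' + i < y' → index σ E (x' + i) = index σ E (x + i)
  index_lt : x' + j < y' → index σ E (x' + j) < index σ E (x + j)

variable {σ E}

/-- Comparison of dominated series, one level below a level at which it and the decrease of the
ordinals of consecutive series are known. -/
theorem seriesOrdAux_succ_lt_of_dominates {d : ℕ}
    (hD : ∀ x y x' y' j, Dominates σ E x y x' y' j →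
      (∀ i, x < i → i < y → RANK Cr - d ≤ rnk σ i) →
      (∀ i, x' < i → i < y' → RANK Cr - d ≤ rnk σ i) →
      (∀ i, x' < i → i < y' → rnk σ x' ≤ rnk σ i) → ¬ Solving Cr (hSeq σ (y' - 1)) →
      seriesOrdAux σ E d x' y' < seriesOrdAux σ E d x y)
    (hNS : ∀ m n, m ≤ n → ¬ Solving Cr (hSeq σ n) → ¬ Solving Cr (hSeq σ m))
    {y' : ℕ} (hns : ¬ Solving Cr (hSeq σ (y' - 1)))
    (hT : ∀ x c c', c' ≤ y' → x < c → c < c' → rnk σ c = RANK Cr - (d + 1) →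
      (∀ i, x < i → i < c → RANK Cr - d ≤ rnk σ i) →
      (∀ i, c < i → i < c' → RANK Cr - d ≤ rnk σ i) →
      (rnk σ x ≤ rnk σ c) →
      seriesOrdAux σ E d c c' < seriesOrdAux σ E d x c) :
    ∀ (n x y x' j : ℕ), y' - x' ≤ n → Dominates σ E x y x' y' j →
      (∀ i, x < i → i < y → RANK Cr - (d + 1) ≤ rnk σ i) →
      (∀ i, x' < i → i < y' → RANK Cr - (d + 1) ≤ rnk σ i) →
      (∀ i, x' < i → i < y' → rnk σ x' ≤ rnk σ i) →
      seriesOrdAux σ E (d + 1) x' y' < seriesOrdAux σ E (d + 1) x y := by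
  intro n
  induction n with
  | zero => intro x y x' j h h'; have := h'.lt'; omega
  | succ n ih =>
    intro x y x' j hn hdom hr hr' hx'
    obtain ⟨hj, hlt', hreq, haeq, halt⟩ := hdom
    have hlast := seriesOrdAux_lt_two_opow_succ σ E hT _ x' le_rfl hlt' hr' hx'
    -- the first piece `[x', z')` of the first series, and the first piece `[x, z)` of the second
    have hfirst : ∃ z', x' < z' ∧ z' ≤ y' ∧
        (∀ i, x' < i → i < z' → rnk σ i ≠ RANK Cr - (d + 1)) ∧
        seriesOrdAux σ E (d + 1) x' y' < 2 ^ Order.succ (seriesOrdAux σ E d x' z') ∧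
        ((z' = y' ∧ seriesOrdAux σ E (d + 1) x' y' = 2 ^ seriesOrdAux σ E d x' z') ∨
          FirstCut σ (RANK Cr - (d + 1)) x' y' z') := by
      rcases no_cut_or_firstCut σ (RANK Cr - (d + 1)) x' y' with h | ⟨c, h⟩
      · exact ⟨y', hlt', le_rfl, h, hlast.2 h, .inl ⟨rfl, seriesOrdAux_of_no_cut σ E h⟩⟩
      · exact ⟨c, h.1, h.2.1.le, h.2.2.2, hlast.1 c h, .inr h⟩
    obtain ⟨z', hz1, hz2, hz3, hz4, hz5⟩ := hfirst
    have hsecond : ∃ z, x < z ∧ z ≤ y ∧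
        (∀ i, x < i → i < z → rnk σ i ≠ RANK Cr - (d + 1)) ∧
        2 ^ seriesOrdAux σ E d x z ≤ seriesOrdAux σ E (d + 1) x y ∧
        (z = y ∨ FirstCut σ (RANK Cr - (d + 1)) x y z) := by
      rcases no_cut_or_firstCut σ (RANK Cr - (d + 1)) x y with h | ⟨c, h⟩
      · exact ⟨y, by omega, le_rfl, h, (seriesOrdAux_of_no_cut σ E h).ge, .inl rfl⟩
      · exact ⟨c, h.1, h.2.1.le, h.2.2.2, two_opow_first_le_seriesOrdAux σ E h, .inr h⟩
    obtain ⟨z, hw1, hw2, hw3, hw4, hw5⟩ := hsecond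
    have hlow : ∀ i, x < i → i < z → RANK Cr - d ≤ rnk σ i := by
      intro i h1 h2
      have := hr i h1 (by omega)
      have := hw3 i h1 h2
      omega
    have hlow' : ∀ i, x' < i → i < z' → RANK Cr - d ≤ rnk σ i := by
      intro i h1 h2
      have := hr' i h1 (by omega)
      have := hz3 i h1 h2
      omega
    have hnsz : ¬ Solving Cr (hSeq σ (z' - 1)) := hNS _ _ (by omega) hns
    -- Once the first exponent is smaller, the later pieces of the first series cannot make up for
    -- it.
    have conclude : seriesOrdAux σ E d x' z' < seriesOrdAux σ E d x z →
        seriesOrdAux σ E (d + 1) x' y' < seriesOrdAux σ E (d + 1) x y := fun h =>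
      hz4.trans_le ((Ordinal.opow_le_opow_right two_pos (Order.succ_le_of_lt h)).trans hw4)
    -- A cut of the first series within the range of agreement is also a cut of the second. The
    -- first pieces then have equal ordinals and cancel, and the comparison passes to the
    -- remainders.
    by_cases hcut : FirstCut σ (RANK Cr - (d + 1)) x' y' z' ∧ z' ≤ x' + j
    · obtain ⟨hcut, hzj⟩ := hcut
      obtain ⟨q, rfl⟩ : ∃ q, z' = x' + q := ⟨z' - x', by omega⟩
      have hcut2 : FirstCut σ (RANK Cr - (d + 1)) x y (x + q) := by
        refine ⟨by omega, by omega, ?_, fun i h1 h2 => ?_⟩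
        · rw [← hreq q (by omega) (by omega) hcut.2.1, hcut.2.2.1]
        · obtain ⟨s, rfl⟩ : ∃ s, i = x + s := ⟨i - x, by omega⟩
          rw [← hreq s (by omega) (by omega) (by omega)]
          exact hz3 _ (by omega) (by omega)
      rw [seriesOrdAux_of_firstCut σ E hcut, seriesOrdAux_of_firstCut σ E hcut2,
        seriesOrdAux_congr σ E d q x x' (by omega)
          (fun i h1 h2 => hreq i h1 (by omega) (by omega))
          (fun i h1 => haeq i (by omega) (by omega))]
      gcongr
      refine ih (x + q) y (x' + q) (j - q) (by omega) ⟨by omega, hcut.2.1, ?_, ?_, ?_⟩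
        (fun i h1 h2 => hr i (by omega) h2) (fun i h1 h2 => hr' i (by omega) h2)
        (fun i h1 h2 => by rw [hcut.2.2.1]; exact hr' i (by omega) h2)
      · intro i h1 h2 h3
        simpa only [add_assoc] using hreq (q + i) (by omega) (by omega) (by omega)
      · intro i h1 h2
        simpa only [add_assoc] using haeq (q + i) (by omega) (by omega)
      · intro h
        have e1 : x' + q + (j - q) = x' + j := by omega
        have e2 : x + q + (j - q) = x + j := by omega
        rw [e1] at h
        rw [e1, e2]
        exact halt h
    -- Either the place of difference lies in the first piece of the second series, and level `d`
    -- applies to the first pieces, or that piece ends earlier.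
    · by_cases hzj : x + j < z
      · refine conclude (hD x z x' z' j ⟨hzj, hz1, fun i h1 h2 h3 => hreq i h1 h2 (by omega),
          fun i h1 h2 => haeq i h1 (by omega), fun h => halt (by omega)⟩ hlow hlow'
          (fun i h1 h2 => hx' i h1 (by omega)) hnsz)
      · have hwcut : FirstCut σ (RANK Cr - (d + 1)) x y z := hw5.resolve_left (by omega)
        obtain ⟨q, rfl⟩ : ∃ q, z = x + q := ⟨z - x, by omega⟩
        -- A first series reaching past `x' + q` would inherit the cut at `x + q`, which is the case
        -- already treated.
        have hy' : y' ≤ x' + q := by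
          by_contra! hlt
          have hrq : rnk σ (x' + q) = RANK Cr - (d + 1) := by
            rw [hreq q (by omega) (by omega) hlt, hwcut.2.2.1]
          have hz'q : z' ≤ x' + q := by
            by_contra! h
            exact hz3 _ (by omega) h hrq
          rcases hz5 with ⟨h, -⟩ | h
          · omega
          · exact hcut ⟨h, by omega⟩
        have hz'y : z' = y' ∧ seriesOrdAux σ E (d + 1) x' y' = 2 ^ seriesOrdAux σ E d x' z' := by
          refine hz5.resolve_right fun h => hcut ⟨h, ?_⟩
          have := h.2.1
          omega
        rcases hy'.eq_or_lt with h | h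
        -- The first series equals the first piece of the second one in ordinal, and the second has
        -- a further positive summand.
        · rw [hz'y.2, seriesOrdAux_of_firstCut σ E hwcut, hz'y.1, h,
            seriesOrdAux_congr σ E d q x x' (by omega)
              (fun i h1 h2 => hreq i h1 (by omega) (by omega))
              (fun i h1 => haeq i (by omega) (by omega))]
          exact lt_add_of_pos_right _ (seriesOrdAux_succ_pos σ E d _ _)
        -- The first series is over by place `x' + (q - 1)`, so the strict inequality of indices is
        -- required vacuously.
        · refine conclude (hD x (x + q) x' z' (q - 1) ⟨by omega, hz1,
            fun i h1 h2 h3 => hreq i h1 (by omega) (by omega),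
            fun i h1 h2 => haeq i (by omega) (by omega), fun h => by omega⟩ hlow hlow'
            (fun i h1 h2 => hx' i h1 (by omega)) hnsz)

/-- For consecutive series that start with nondecreasing ranks, the ordinals decrease, provided that
the second series is dominated by a final part of the first one. -/
theorem seriesOrdAux_lt_of_consecutive
    (hR : ∀ n, rnk σ n < RANK Cr)
    (hNS : ∀ m n, m ≤ n → ¬ Solving Cr (hSeq σ n) → ¬ Solving Cr (hSeq σ m))
    (hdom : ∀ x a b, x < a → a < b → ¬ Solving Cr (hSeq σ (b - 1)) → rnk σ x ≤ rnk σ a →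
      (∀ i, x < i → i < a → rnk σ a < rnk σ i) → ∃ j, Dominates σ E x a a b j) (d : ℕ) :
    ∀ m a b, m < a → a < b → ¬ Solving Cr (hSeq σ (b - 1)) → rnk σ m ≤ rnk σ a →
      (∀ i, a < i → i < b → rnk σ a ≤ rnk σ i) →
      (∀ i, m < i → i < a → RANK Cr - d ≤ rnk σ i) →
      (∀ i, a < i → i < b → RANK Cr - d ≤ rnk σ i) →
      seriesOrdAux σ E d a b < seriesOrdAux σ E d m a := by
  -- Domination at a level yields decrease at the same level: the initial part before the last place
  -- of rank at most `rnk σ a` is omitted.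
  have step : ∀ d, (∀ x y x' y' j, Dominates σ E x y x' y' j →
      (∀ i, x < i → i < y → RANK Cr - d ≤ rnk σ i) →
      (∀ i, x' < i → i < y' → RANK Cr - d ≤ rnk σ i) →
      (∀ i, x' < i → i < y' → rnk σ x' ≤ rnk σ i) → ¬ Solving Cr (hSeq σ (y' - 1)) →
      seriesOrdAux σ E d x' y' < seriesOrdAux σ E d x y) →
      ∀ m a b, m < a → a < b → ¬ Solving Cr (hSeq σ (b - 1)) → rnk σ m ≤ rnk σ a →
      (∀ i, a < i → i < b → rnk σ a ≤ rnk σ i) →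
      (∀ i, m < i → i < a → RANK Cr - d ≤ rnk σ i) →
      (∀ i, a < i → i < b → RANK Cr - d ≤ rnk σ i) →
      seriesOrdAux σ E d a b < seriesOrdAux σ E d m a := by
    intro d hD m a b hma hab hns hra hb h1 h2
    obtain ⟨x, hmx, hxa, hx, hlast⟩ : ∃ x, m ≤ x ∧ x < a ∧ rnk σ x ≤ rnk σ a ∧
        ∀ i, x < i → i < a → rnk σ a < rnk σ i := by
      classical
      have hne : ((Finset.Ico m a).filter fun i => rnk σ i ≤ rnk σ a).Nonempty :=
        ⟨m, by simp [hma, hra]⟩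
      obtain ⟨x, hx, hmax⟩ := Finset.exists_max_image _ id hne
      simp only [Finset.mem_filter, Finset.mem_Ico, id] at hx hmax
      refine ⟨x, hx.1.1, hx.1.2, hx.2, fun i hxi hia => ?_⟩
      by_contra! h
      have := hmax i ⟨⟨by omega, hia⟩, h⟩
      omega
    obtain ⟨j, hj⟩ := hdom x a b hxa hab hns hx hlast
    exact (hD x a a b j hj (fun i hi => h1 i (by omega)) h2 hb hns).trans_le
      (seriesOrdAux_suffix_le σ E hR d _ m a x le_rfl hmx hxa h1)
  have hD : ∀ d, ∀ x y x' y' j, Dominates σ E x y x' y' j →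
      (∀ i, x < i → i < y → RANK Cr - d ≤ rnk σ i) →
      (∀ i, x' < i → i < y' → RANK Cr - d ≤ rnk σ i) →
      (∀ i, x' < i → i < y' → rnk σ x' ≤ rnk σ i) → ¬ Solving Cr (hSeq σ (y' - 1)) →
      seriesOrdAux σ E d x' y' < seriesOrdAux σ E d x y := by
    intro d
    induction d with
    | zero =>
      intro x y x' y' j hj hr _ _ _
      -- At level $\mathrm{RANK}$ the dominating series is a singleton, so the difference is at its
      -- first term, where the ordinals are the indices.
      obtain rfl : j = 0 := by
        by_contra h
        have h1 := hr (x + 1) (by omega) (by have := hj.lt; omega)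
        have := hR (x + 1)
        omega
      exact hj.index_lt hj.lt'
    | succ d ih =>
      intro x y x' y' j hj hr hr' hx' hns
      refine seriesOrdAux_succ_lt_of_dominates ih hNS hns ?_ _ x y x' j le_rfl hj hr hr' hx'
      intro x c c' hc' hxc hcc' hrc h1 h2 hx
      refine step d ih x c c' hxc hcc' (hNS _ _ (by omega) hns) hx (fun i hi hic => ?_) h1 h2
      have := h2 i hi hic
      omega
  exact step d (hD d)

end Series

/-! ### Evaluation, ranks and instances of expressions -/

namespace Exp

variable {L : ArithLang}

/-! ### The irreducible form of a compound expression -/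

open Classical in
/-- The irreducible form of `f(us)` for irreducible `us`. -/
noncomputable def evalFn {k : ℕ} (f : L.Fn k) (us : Fin k → Exp L .term) : Exp L .term :=
  if ∀ j, (us j).IsNum then num (L.fnVal f fun j => (us j).toNat) else fn f us

open Classical in
/-- The irreducible form of `R(us)` for irreducible `us`. -/
noncomputable def evalRel {k : ℕ} (R : L.Rel k) (us : Fin k → Exp L .term) : Exp L .formula :=
  if ∀ j, (us j).IsNum then truth (L.relVal R fun j => (us j).toNat) else rel R us

open Classical in
/-- The irreducible form of `εx. F` for irreducible `F`. -/
noncomputable def evalEps (s : Exp L .term → ℕ) (F : Exp L .formula) : Exp L .term :=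
  if (eps F).Closed then num (s (eps F)) else eps F

open Classical in
/-- The irreducible form of `¬ A` for irreducible `A`. -/
noncomputable def evalNeg (A : Exp L .formula) : Exp L .formula :=
  if A.IsTruth then truth (!A.toBool) else neg A

open Classical in
/-- The irreducible form of a binary connective applied to irreducible formulas. -/
noncomputable def evalConn (c : Conn) (A B : Exp L .formula) : Exp L .formula :=
  if A.IsTruth ∧ B.IsTruth then truth (c.val A.toBool B.toBool) else conn c A B

theorem reduce_fn (s : Exp L .term → ℕ) {k : ℕ} (f : L.Fn k) (ts : Fin k → Exp L .term) :
    reduce s (fn f ts) = evalFn f fun j => reduce s (ts j) := by rw [reduce, evalFn]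

theorem reduce_rel (s : Exp L .term → ℕ) {k : ℕ} (R : L.Rel k) (ts : Fin k → Exp L .term) :
    reduce s (rel R ts) = evalRel R fun j => reduce s (ts j) := by rw [reduce, evalRel]

theorem reduce_eps (s : Exp L .term → ℕ) (F : Exp L .formula) :
    reduce s (eps F) = evalEps s (reduce s F) := by rw [reduce, evalEps]

theorem reduce_neg (s : Exp L .term → ℕ) (A : Exp L .formula) :
    reduce s (neg A) = evalNeg (reduce s A) := by rw [reduce, evalNeg]

theorem reduce_conn (s : Exp L .term → ℕ) (c : Conn) (A B : Exp L .formula) :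
    reduce s (conn c A B) = evalConn c (reduce s A) (reduce s B) := by rw [reduce, evalConn]

/-! ### Closed expressions have values -/

/-- A numeral or a truth value. -/
def IsValue : {κ : Kind} → Exp L κ → Prop
  | _, num _ => True
  | _, truth _ => True
  | _, _ => False

theorem isNum_iff_isValue (t : Exp L .term) : t.IsNum ↔ t.IsValue := by
  cases t <;> simp [IsNum, IsValue]

theorem isTruth_iff_isValue (A : Exp L .formula) : A.IsTruth ↔ A.IsValue := by
  cases A <;> simp [IsTruth, IsValue]

theorem isValue_reduce (s : Exp L .term → ℕ) {κ : Kind} (e : Exp L κ) (h : e.Closed) :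
    (reduce s e).IsValue := by
  induction e with
  | var j => exact absurd rfl (h j)
  | num n => simp [reduce, IsValue]
  | fn f ts ih =>
    have : ∀ j, (reduce s (ts j)).IsNum := fun j =>
      (isNum_iff_isValue _).2 (ih j fun i hi => h i ⟨j, hi⟩)
    rw [reduce, if_pos this]
    trivial
  | eps F ih =>
    have : (eps (reduce s F)).Closed := fun i hi => h i ((hasVar_reduce s F (i + 1)).1 hi)
    rw [reduce, if_pos this]
    trivial
  | truth b => simp [reduce, IsValue]
  | rel R ts ih =>
    have : ∀ j, (reduce s (ts j)).IsNum := fun j =>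
      (isNum_iff_isValue _).2 (ih j fun i hi => h i ⟨j, hi⟩)
    rw [reduce, if_pos this]
    trivial
  | neg A ih =>
    have : (reduce s A).IsTruth := (isTruth_iff_isValue _).2 (ih h)
    rw [reduce, if_pos this]
    trivial
  | conn c A B ihA ihB =>
    have hA : (reduce s A).IsTruth :=
      (isTruth_iff_isValue _).2 (ihA fun i hi => h i (.inl hi))
    have hB : (reduce s B).IsTruth :=
      (isTruth_iff_isValue _).2 (ihB fun i hi => h i (.inr hi))
    rw [reduce, if_pos ⟨hA, hB⟩]
    trivial

theorem reduce_term (s : Exp L .term → ℕ) {t : Exp L .term} (h : t.Closed) :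
    reduce s t = num (reduce s t).toNat := by
  obtain ⟨n, hn⟩ := (isNum_iff_isValue _).2 (isValue_reduce s t h)
  rw [hn, toNat]

theorem reduce_formula (s : Exp L .term → ℕ) {A : Exp L .formula} (h : A.Closed) :
    reduce s A = truth (reduce s A).toBool := by
  obtain ⟨n, hn⟩ := (isTruth_iff_isValue _).2 (isValue_reduce s A h)
  rw [hn, toBool]

theorem closed_eps_reduce_iff (s : Exp L .term → ℕ) (F : Exp L .formula) :
    (eps (reduce s F)).Closed ↔ (eps F).Closed := by
  simp [Closed, HasVar, hasVar_reduce]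

theorem reduce_eps_of_closed (s : Exp L .term → ℕ) {F : Exp L .formula} (h : (eps F).Closed) :
    reduce s (eps F) = num (s (eps (reduce s F))) := by
  rw [reduce, if_pos ((closed_eps_reduce_iff s F).2 h)]

/-! ### The closed epsilon terms of an expression -/

theorem mem_closedEps_fn {k : ℕ} {f : L.Fn k} {ts : Fin k → Exp L .term} {t : Exp L .term} :
    t ∈ (fn f ts).closedEps ↔ ∃ j, t ∈ (ts j).closedEps := by simp [closedEps]

theorem mem_closedEps_rel {k : ℕ} {R : L.Rel k} {ts : Fin k → Exp L .term} {t : Exp L .term} :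
    t ∈ (rel R ts).closedEps ↔ ∃ j, t ∈ (ts j).closedEps := by simp [closedEps]

theorem mem_closedEps_eps {F : Exp L .formula} {t : Exp L .term} :
    t ∈ (eps F).closedEps ↔ t ∈ F.closedEps ∨ (eps F).Closed ∧ t = eps F := by
  by_cases h : (eps F).Closed <;> simp [closedEps, h, or_comm]

theorem mem_closedEps_conn {c : Conn} {A B : Exp L .formula} {t : Exp L .term} :
    t ∈ (conn c A B).closedEps ↔ t ∈ A.closedEps ∨ t ∈ B.closedEps := by simp [closedEps]

theorem exists_eps_of_mem_closedEps {κ : Kind} {e : Exp L κ} {t : Exp L .term}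
    (h : t ∈ e.closedEps) : ∃ G, t = eps G ∧ (eps G).Closed := by
  induction e with
  | var j => simp [closedEps] at h
  | num n => simp [closedEps] at h
  | truth b => simp [closedEps] at h
  | fn f ts ih =>
    obtain ⟨j, hj⟩ := mem_closedEps_fn.1 h
    exact ih j hj
  | rel f ts ih =>
    obtain ⟨j, hj⟩ := mem_closedEps_rel.1 h
    exact ih j hj
  | eps F ih =>
    rcases mem_closedEps_eps.1 h with h | ⟨hc, h⟩
    · exact ih h
    · exact ⟨F, h, hc⟩
  | neg A ih => exact ih h
  | conn c A B ihA ihB =>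
    exact (mem_closedEps_conn.1 h).elim ihA ihB

theorem closedEps_subset_of_mem {κ : Kind} {e : Exp L κ} {t : Exp L .term}
    (h : t ∈ e.closedEps) : t.closedEps ⊆ e.closedEps := by
  induction e with
  | var j => simp [closedEps] at h
  | num n => simp [closedEps] at h
  | truth b => simp [closedEps] at h
  | fn f ts ih =>
    obtain ⟨j, hj⟩ := mem_closedEps_fn.1 h
    exact fun u hu => mem_closedEps_fn.2 ⟨j, ih j hj hu⟩
  | rel f ts ih =>
    obtain ⟨j, hj⟩ := mem_closedEps_rel.1 h
    exact fun u hu => mem_closedEps_rel.2 ⟨j, ih j hj hu⟩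
  | eps F ih =>
    rcases mem_closedEps_eps.1 h with h | ⟨hc, h⟩
    · exact fun u hu => mem_closedEps_eps.2 (.inl (ih h hu))
    · rw [h]
  | neg A ih => exact ih h
  | conn c A B ihA ihB =>
    exact fun u hu => mem_closedEps_conn.2
      ((mem_closedEps_conn.1 h).imp (fun h => ihA h hu) fun h => ihB h hu)

/-- The depth of an expression. -/
def depth : {κ : Kind} → Exp L κ → ℕ
  | _, var _ => 0
  | _, num _ => 0
  | _, fn _ ts => Finset.univ.sup fun j => (ts j).depth
  | _, eps F => F.depth + 1
  | _, truth _ => 0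
  | _, rel _ ts => Finset.univ.sup fun j => (ts j).depth
  | _, neg A => A.depth
  | _, conn _ A B => max A.depth B.depth

theorem depth_le_of_mem_closedEps {κ : Kind} {e : Exp L κ} {t : Exp L .term}
    (h : t ∈ e.closedEps) : t.depth ≤ e.depth := by
  induction e with
  | var j => simp [closedEps] at h
  | num n => simp [closedEps] at h
  | truth b => simp [closedEps] at h
  | fn f ts ih =>
    obtain ⟨j, hj⟩ := mem_closedEps_fn.1 h
    exact (ih j hj).trans (Finset.le_sup (f := fun j => (ts j).depth) (Finset.mem_univ j))
  | rel f ts ih =>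
    obtain ⟨j, hj⟩ := mem_closedEps_rel.1 h
    exact (ih j hj).trans (Finset.le_sup (f := fun j => (ts j).depth) (Finset.mem_univ j))
  | eps F ih =>
    rcases mem_closedEps_eps.1 h with h | ⟨hc, h⟩
    · exact (ih h).trans (Nat.le_succ _)
    · rw [h]
  | neg A ih => exact ih h
  | conn c A B ihA ihB =>
    exact (mem_closedEps_conn.1 h).elim (fun h => (ihA h).trans (le_max_left _ _))
      (fun h => (ihB h).trans (le_max_right _ _))

theorem ne_eps_of_mem_closedEps {G : Exp L .formula} {t : Exp L .term} (h : t ∈ G.closedEps) :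
    t ≠ eps G := by
  rintro rfl
  have := depth_le_of_mem_closedEps h
  simp [depth] at this

theorem eps_mem_closedEps {F : Exp L .formula} (h : (eps F).Closed) :
    eps F ∈ (eps F).closedEps := by
  simp [closedEps, h]

theorem closedEps_subset_eps (F : Exp L .formula) : F.closedEps ⊆ (eps F).closedEps := by
  exact fun u hu => mem_closedEps_eps.2 (.inl hu)

/-- The irreducible form depends only on the values of the closed epsilon terms. -/
theorem reduce_congr {s s' : Exp L .term → ℕ} {κ : Kind} (e : Exp L κ)
    (h : ∀ t ∈ e.closedEps, reduce s t = reduce s' t) : reduce s e = reduce s' e := by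
  induction e with
  | var j => simp [reduce]
  | num n => simp [reduce]
  | truth b => simp [reduce]
  | fn f ts ih =>
    have : (fun j => reduce s (ts j)) = fun j => reduce s' (ts j) := by
      funext j
      exact ih j fun t ht => h t (mem_closedEps_fn.2 ⟨j, ht⟩)
    rw [reduce_fn, reduce_fn, this]
  | rel f ts ih =>
    have : (fun j => reduce s (ts j)) = fun j => reduce s' (ts j) := by
      funext j
      exact ih j fun t ht => h t (mem_closedEps_rel.2 ⟨j, ht⟩)
    rw [reduce_rel, reduce_rel, this]
  | eps F ih =>
    by_cases hc : (eps F).Closed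
    · exact h _ (eps_mem_closedEps hc)
    · have hc' (u : Exp L .term → ℕ) : ¬ (eps (reduce u F)).Closed := by
        rwa [closed_eps_reduce_iff]
      rw [reduce, reduce, if_neg (hc' s), if_neg (hc' s'),
        ih fun t ht => h t (closedEps_subset_eps F ht)]
  | neg A ih =>
    rw [reduce_neg, reduce_neg, ih h]
  | conn c A B ihA ihB =>
    rw [reduce_conn, reduce_conn, ihA fun t ht => h t (mem_closedEps_conn.2 (.inl ht)),
      ihB fun t ht => h t (mem_closedEps_conn.2 (.inr ht))]

/-! ### Ranks -/

theorem subRank_reduce_le (s : Exp L .term → ℕ) {κ : Kind} (e : Exp L κ) :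
    ∀ i, (reduce s e).subRank i ≤ e.subRank i := by
  induction e with
  | var j => intro i; simp [reduce]
  | num n => intro i; simp [reduce]
  | truth b => intro i; simp [reduce]
  | fn f ts ih =>
    intro i
    rw [reduce]
    split_ifs
    · simp [subRank]
    · exact Finset.sup_mono_fun fun j _ => ih j i
  | rel f ts ih =>
    intro i
    rw [reduce]
    split_ifs
    · simp [subRank]
    · exact Finset.sup_mono_fun fun j _ => ih j i
  | eps F ih =>
    intro i
    rw [reduce]
    split_ifs
    · simp [subRank]
    · refine max_le_max ?_ (ih _)
      split_ifs with h1 h2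
      · exact Nat.succ_le_succ (ih 0)
      · exact absurd ((hasVar_reduce s F _).1 h1) h2
      · exact Nat.zero_le _
      · exact le_rfl
  | neg A ih =>
    intro i
    rw [reduce]
    split_ifs
    · simp [subRank]
    · exact ih i
  | conn c A B ihA ihB =>
    intro i
    rw [reduce]
    split_ifs
    · simp [subRank]
    · exact max_le_max (ihA i) (ihB i)

theorem rank_reduce_le (s : Exp L .term → ℕ) {κ : Kind} (e : Exp L κ) :
    (reduce s e).rank ≤ e.rank := by
  induction e with
  | var j => simp [reduce]
  | num n => simp [reduce]
  | truth b => simp [reduce]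
  | fn f ts ih =>
    rw [reduce]
    split_ifs
    · simp [rank]
    · exact Finset.sup_mono_fun fun j _ => ih j
  | rel f ts ih =>
    rw [reduce]
    split_ifs
    · simp [rank]
    · exact Finset.sup_mono_fun fun j _ => ih j
  | eps F ih =>
    rw [reduce]
    split_ifs
    · simp [rank]
    · exact max_le_max (Nat.succ_le_succ (subRank_reduce_le s F 0)) ih
  | neg A ih =>
    rw [reduce]
    split_ifs
    · simp [rank]
    · exact ih
  | conn c A B ihA ihB =>
    rw [reduce]
    split_ifs
    · simp [rank]
    · exact max_le_max ihA ihB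

theorem rank_eps_reduce_le (s : Exp L .term → ℕ) (F : Exp L .formula) :
    (eps (reduce s F)).rank ≤ (eps F).rank :=
  max_le_max (Nat.succ_le_succ (subRank_reduce_le s F 0)) (rank_reduce_le s F)

/-- The irreducible form depends only on the substitution on terms of rank at most that of the
closed epsilon terms of the expression. -/
theorem reduce_congr_of_rank_le {s s' : Exp L .term → ℕ} {r : ℕ}
    (hs : ∀ f : Exp L .term, f.rank ≤ r → s f = s' f) {κ : Kind} (e : Exp L κ)
    (h : ∀ t ∈ e.closedEps, t.rank ≤ r) : reduce s e = reduce s' e := by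
  induction e with
  | var j => simp [reduce]
  | num n => simp [reduce]
  | truth b => simp [reduce]
  | fn f ts ih =>
    have : (fun j => reduce s (ts j)) = fun j => reduce s' (ts j) := by
      funext j
      exact ih j fun t ht => h t (mem_closedEps_fn.2 ⟨j, ht⟩)
    rw [reduce_fn, reduce_fn, this]
  | rel f ts ih =>
    have : (fun j => reduce s (ts j)) = fun j => reduce s' (ts j) := by
      funext j
      exact ih j fun t ht => h t (mem_closedEps_rel.2 ⟨j, ht⟩)
    rw [reduce_rel, reduce_rel, this]
  | eps F ih =>
    have hF := ih fun t ht => h t (closedEps_subset_eps F ht)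
    by_cases hc : (eps F).Closed
    · rw [reduce_eps_of_closed s hc, reduce_eps_of_closed s' hc, ← hF,
        hs _ ((rank_eps_reduce_le s F).trans (h _ (eps_mem_closedEps hc)))]
    · have hc' (u : Exp L .term → ℕ) : ¬ (eps (reduce u F)).Closed := by
        rwa [closed_eps_reduce_iff]
      rw [reduce, reduce, if_neg (hc' s), if_neg (hc' s'), hF]
  | neg A ih =>
    rw [reduce_neg, reduce_neg, ih h]
  | conn c A B ihA ihB =>
    rw [reduce_conn, reduce_conn, ihA fun t ht => h t (mem_closedEps_conn.2 (.inl ht)),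
      ihB fun t ht => h t (mem_closedEps_conn.2 (.inr ht))]

/-- Every epsilon term in `e` has a free variable. If this variable is bound further out in `e`, the
binding epsilon term has larger rank; so a term of maximal rank contains a variable that is free in
`e`. -/
theorem rank_eq_zero_or_le_subRank {κ : Kind} (e : Exp L κ) (h : e.closedEps = ∅) :
    e.rank = 0 ∨ ∃ i, e.HasVar i ∧ e.rank ≤ e.subRank i := by
  have fam : ∀ {k : ℕ} (ts : Fin k → Exp L .term),
      (∀ j, (ts j).rank = 0 ∨ ∃ i, (ts j).HasVar i ∧ (ts j).rank ≤ (ts j).subRank i) →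
      (Finset.univ.sup fun j => (ts j).rank) = 0 ∨
        ∃ i, (∃ j, (ts j).HasVar i) ∧
          (Finset.univ.sup fun j => (ts j).rank) ≤ Finset.univ.sup fun j => (ts j).subRank i := by
    intro k ts hts
    by_cases h0 : (Finset.univ.sup fun j => (ts j).rank) = 0
    · exact .inl h0
    · right
      have hne : (Finset.univ : Finset (Fin k)).Nonempty := by
        by_contra hne
        rw [Finset.not_nonempty_iff_eq_empty] at hne
        simp [hne] at h0
      obtain ⟨j, -, hj⟩ := Finset.exists_mem_eq_sup _ hne fun j => (ts j).rank
      rw [hj] at h0 ⊢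
      obtain ⟨i, hi, hle⟩ := (hts j).resolve_left h0
      exact ⟨i, ⟨j, hi⟩, hle.trans
        (Finset.le_sup (f := fun j => (ts j).subRank i) (Finset.mem_univ j))⟩
  induction e with
  | var j => simp [rank]
  | num n => simp [rank]
  | truth b => simp [rank]
  | fn f ts ih =>
    refine fam ts fun j => ih j (Finset.eq_empty_of_forall_notMem fun u hu =>
      Finset.eq_empty_iff_forall_notMem.1 h u (mem_closedEps_fn.2 ⟨j, hu⟩))
  | rel f ts ih =>
    refine fam ts fun j => ih j (Finset.eq_empty_of_forall_notMem fun u hu =>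
      Finset.eq_empty_iff_forall_notMem.1 h u (mem_closedEps_rel.2 ⟨j, hu⟩))
  | eps F ih =>
    have hnc : ¬ (eps F).Closed := fun hc => by
      have := eps_mem_closedEps hc
      simp [h] at this
    obtain ⟨i, hi⟩ : ∃ i, F.HasVar (i + 1) := by simpa [Closed, HasVar] using hnc
    have hF : F.closedEps = ∅ :=
      Finset.subset_empty.1 ((closedEps_subset_eps F).trans h.subset)
    have hsub : F.subRank 0 + 1 ≤ (eps F).subRank i := by simp [subRank, hi]
    right
    rcases ih hF with h0 | ⟨i', hi', hle⟩
    · exact ⟨i, hi, max_le hsub (by rw [h0]; exact Nat.zero_le _)⟩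
    · rcases i' with _ | i'
      · exact ⟨i, hi, max_le hsub (by omega)⟩
      · by_cases hcase : F.rank ≤ F.subRank 0 + 1
        · exact ⟨i, hi, max_le hsub (hcase.trans hsub)⟩
        · have : F.subRank (i' + 1) ≤ (eps F).subRank i' := by simp [subRank]
          exact ⟨i', hi', max_le (by omega) (by omega)⟩
  | neg A ih => exact ih h
  | conn c A B ihA ihB =>
    replace h : A.closedEps = ∅ ∧ B.closedEps = ∅ := by
      simp only [Finset.eq_empty_iff_forall_notMem, mem_closedEps_conn, not_or] at h ⊢
      exact ⟨fun u => (h u).1, fun u => (h u).2⟩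
    rcases le_total A.rank B.rank with hle | hle
    · rcases ihB h.2 with h0 | ⟨i, hi, hB⟩
      · left; simp only [rank]; omega
      · exact .inr ⟨i, .inr hi, by simp only [rank, subRank]; omega⟩
    · rcases ihA h.1 with h0 | ⟨i, hi, hA⟩
      · left; simp only [rank]; omega
      · exact .inr ⟨i, .inl hi, by simp only [rank, subRank]; omega⟩

/-! ### Instances -/

theorem hasVar_inst {t : Exp L .term} (ht : t.Closed) {κ : Kind} (e : Exp L κ) :
    ∀ i j, (inst t e i).HasVar j ↔ (j < i ∧ e.HasVar j) ∨ (i ≤ j ∧ e.HasVar (j + 1)) := by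
  induction e with
  | var q =>
    intro i j
    rw [inst]
    split_ifs with h1 h2
    · have := ht j
      simp only [HasVar, this, false_iff]
      omega
    · simp only [HasVar]; omega
    · simp only [HasVar]; omega
  | num n => intro i j; simp [inst, HasVar]
  | truth b => intro i j; simp [inst, HasVar]
  | fn f ts ih =>
    intro i j
    simp only [inst, HasVar, ih, exists_or, exists_and_left]
  | rel f ts ih =>
    intro i j
    simp only [inst, HasVar, ih, exists_or, exists_and_left]
  | eps F ih =>
    intro i j
    simp only [inst, HasVar, ih, add_lt_add_iff_right, add_le_add_iff_right]
  | neg A ih => intro i j; simp only [inst, HasVar, ih]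
  | conn c A B ihA ihB =>
    intro i j
    simp only [inst, HasVar, ihA, ihB]
    tauto

theorem closed_inst {t : Exp L .term} (ht : t.Closed) {F : Exp L .formula} (hF : (eps F).Closed) :
    (inst t F 0).Closed := by
  intro i hi
  rw [hasVar_inst ht] at hi
  exact hF i (by simpa [HasVar] using hi)

theorem closed_num (n : ℕ) : (num n : Exp L .term).Closed := fun _ h => h

theorem inst_eq_self (t : Exp L .term) {κ : Kind} (e : Exp L κ) :
    ∀ i, (∀ j, e.HasVar j → j < i) → inst t e i = e := by
  induction e with
  | var q =>
    intro i h
    have := h q rfl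
    rw [inst, if_neg (by omega), if_neg (by omega)]
  | num n => intro i h; rfl
  | truth b => intro i h; rfl
  | fn f ts ih =>
    intro i h
    simp only [inst]
    congr 1
    funext j
    exact ih j i fun q hq => h q ⟨j, hq⟩
  | rel f ts ih =>
    intro i h
    simp only [inst]
    congr 1
    funext j
    exact ih j i fun q hq => h q ⟨j, hq⟩
  | eps F ih =>
    intro i h
    rw [inst, ih (i + 1)]
    rintro (_ | j) hj
    · omega
    · exact Nat.succ_lt_succ (h j hj)
  | neg A ih => intro i h; rw [inst, ih i h]
  | conn c A B ihA ihB =>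
    intro i h
    rw [inst, ihA i fun j hj => h j (.inl hj), ihB i fun j hj => h j (.inr hj)]

/-- A closed term may be replaced by its value, and the rest of the expression by its irreducible
form, before an expression is evaluated. -/
theorem reduce_inst (s : Exp L .term → ℕ) {t : Exp L .term} (ht : t.Closed) {κ : Kind}
    (e : Exp L κ) : ∀ i,
      reduce s (inst t e i) = reduce s (inst (num (reduce s t).toNat) (reduce s e) i) := by
  induction e with
  | var q =>
    intro i
    simp only [reduce, inst]
    split_ifs
    · rw [reduce_term s ht, reduce]; simp [toNat]
    · rfl
    · rfl
  | num n => intro i; simp [reduce, inst]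
  | truth b => intro i; simp [reduce, inst]
  | fn f ts ih =>
    intro i
    by_cases h : ∀ j, (reduce s (ts j)).IsNum
    · have h2 : ∀ j, reduce s (inst t (ts j) i) = reduce s (ts j) := by
        intro j
        obtain ⟨n, hn⟩ := h j
        rw [ih, hn, inst, reduce]
      have h3 : reduce s (inst t (fn f ts) i) = reduce s (fn f ts) := by
        simp only [inst, reduce_fn, h2]
      rw [h3, reduce_fn, evalFn, if_pos h, inst, reduce]
    · rw [reduce_fn s f ts, evalFn, if_neg h]
      simp only [inst, reduce_fn, ih]
  | rel f ts ih =>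
    intro i
    by_cases h : ∀ j, (reduce s (ts j)).IsNum
    · have h2 : ∀ j, reduce s (inst t (ts j) i) = reduce s (ts j) := by
        intro j
        obtain ⟨n, hn⟩ := h j
        rw [ih, hn, inst, reduce]
      have h3 : reduce s (inst t (rel f ts) i) = reduce s (rel f ts) := by
        simp only [inst, reduce_rel, h2]
      rw [h3, reduce_rel, evalRel, if_pos h, inst, reduce]
    · rw [reduce_rel s f ts, evalRel, if_neg h]
      simp only [inst, reduce_rel, ih]
  | eps F ih =>
    intro i
    by_cases h : (eps (reduce s F)).Closed
    · rw [inst_eq_self t (eps F) i fun j hj => absurd hj ((closed_eps_reduce_iff s F).1 h j),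
        reduce, if_pos h, inst, reduce]
    · rw [reduce_eps s F, evalEps, if_neg h]
      simp only [inst, reduce_eps, ih]
  | neg A ih =>
    intro i
    by_cases h : (reduce s A).IsTruth
    · have h2 : reduce s (inst t A i) = reduce s A := by
        obtain ⟨n, hn⟩ := h
        rw [ih, hn, inst, reduce]
      rw [inst, reduce_neg, h2, reduce_neg, evalNeg, if_pos h, inst, reduce]
    · rw [reduce_neg s A, evalNeg, if_neg h]
      simp only [inst, reduce_neg, ih]
  | conn c A B ihA ihB =>
    intro i
    by_cases h : (reduce s A).IsTruth ∧ (reduce s B).IsTruth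
    · have h2 : reduce s (inst t A i) = reduce s A := by
        obtain ⟨n, hn⟩ := h.1
        rw [ihA, hn, inst, reduce]
      have h3 : reduce s (inst t B i) = reduce s B := by
        obtain ⟨n, hn⟩ := h.2
        rw [ihB, hn, inst, reduce]
      rw [inst, reduce_conn, h2, h3, reduce_conn, evalConn, if_pos h, inst, reduce]
    · rw [reduce_conn s c A B, evalConn, if_neg h]
      simp only [inst, reduce_conn, ihA, ihB]

theorem subRank_inst_num_le (n : ℕ) {κ : Kind} (e : Exp L κ) :
    ∀ i j, j < i → (inst (num n) e i).subRank j ≤ e.subRank j := by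
  induction e with
  | var q =>
    intro i j _
    rw [inst]
    split_ifs <;> simp [subRank]
  | num n => intro i j _; exact le_rfl
  | truth b => intro i j _; exact le_rfl
  | fn f ts ih => intro i j hj; exact Finset.sup_mono_fun fun q _ => ih q i j hj
  | rel f ts ih => intro i j hj; exact Finset.sup_mono_fun fun q _ => ih q i j hj
  | eps F ih =>
    intro i j hj
    have : (inst (num n) F (i + 1)).HasVar (j + 1) ↔ F.HasVar (j + 1) := by
      rw [hasVar_inst (closed_num n)]
      simp [hj, Nat.not_le.2 hj]
    refine max_le_max ?_ (ih _ _ (Nat.succ_lt_succ hj))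
    split_ifs with h1 h2
    · exact Nat.succ_le_succ (ih _ _ (Nat.succ_pos _))
    · exact absurd (this.1 h1) h2
    · exact Nat.zero_le _
    · exact le_rfl
  | neg A ih => intro i j hj; exact ih i j hj
  | conn c A B ihA ihB => intro i j hj; exact max_le_max (ihA i j hj) (ihB i j hj)

theorem rank_inst_num_le (n : ℕ) {κ : Kind} (e : Exp L κ) :
    ∀ i, (inst (num n) e i).rank ≤ e.rank := by
  induction e with
  | var q =>
    intro i
    rw [inst]
    split_ifs <;> simp [rank]
  | num n => intro i; exact le_rfl
  | truth b => intro i; exact le_rfl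
  | fn f ts ih => intro i; exact Finset.sup_mono_fun fun q _ => ih q i
  | rel f ts ih => intro i; exact Finset.sup_mono_fun fun q _ => ih q i
  | eps F ih =>
    intro i
    exact max_le_max (Nat.succ_le_succ (subRank_inst_num_le n F _ _ (Nat.succ_pos _))) (ih _)
  | neg A ih => intro i; exact ih i
  | conn c A B ihA ihB => intro i; exact max_le_max (ihA i) (ihB i)

/-- The closed epsilon terms that arise when a variable is replaced by a numeral in an expression
without closed epsilon terms come from epsilon terms that contain the variable. -/
theorem rank_le_subRank_of_mem_closedEps_inst (n : ℕ) {κ : Kind} (e : Exp L κ)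
    (h : e.closedEps = ∅) :
    ∀ i, ∀ t ∈ (inst (num n) e i).closedEps, t.rank ≤ e.subRank i := by
  induction e with
  | var q =>
    intro i t ht
    rw [inst] at ht
    split_ifs at ht <;> simp [closedEps] at ht
  | num n => intro i t ht; simp [inst, closedEps] at ht
  | truth b => intro i t ht; simp [inst, closedEps] at ht
  | fn f ts ih =>
    intro i t ht
    obtain ⟨j, hj⟩ := mem_closedEps_fn.1 ht
    refine (ih j (Finset.eq_empty_of_forall_notMem fun u hu =>
      Finset.eq_empty_iff_forall_notMem.1 h u (mem_closedEps_fn.2 ⟨j, hu⟩)) i t hj).trans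
      (Finset.le_sup (f := fun j => (ts j).subRank i) (Finset.mem_univ j))
  | rel f ts ih =>
    intro i t ht
    obtain ⟨j, hj⟩ := mem_closedEps_rel.1 ht
    refine (ih j (Finset.eq_empty_of_forall_notMem fun u hu =>
      Finset.eq_empty_iff_forall_notMem.1 h u (mem_closedEps_rel.2 ⟨j, hu⟩)) i t hj).trans
      (Finset.le_sup (f := fun j => (ts j).subRank i) (Finset.mem_univ j))
  | eps F ih =>
    intro i t ht
    have hnc : ¬ (eps F).Closed := fun hc => by
      have := eps_mem_closedEps hc
      simp [h] at this
    have hF : F.closedEps = ∅ :=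
      Finset.subset_empty.1 ((closedEps_subset_eps F).trans h.subset)
    have hsub : F.subRank (i + 1) ≤ (eps F).subRank i := le_max_right _ _
    rcases mem_closedEps_eps.1 ht with ht | ⟨hc, ht⟩
    · exact (ih hF _ t ht).trans hsub
    · rw [ht]
      have hvar : ∀ q, F.HasVar q → q = 0 ∨ q = i + 1 := by
        intro q hq
        by_contra! hne
        -- Variable `q` of `F` is `q - 1` outside the binder, and one less again if it lies above
        -- the replaced variable.
        have := hc (if q ≤ i then q - 1 else q - 2)
        simp only [HasVar, hasVar_inst (closed_num n)] at this
        apply this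
        split_ifs with hqi
        · left
          rw [show q - 1 + 1 = q by omega]
          exact ⟨by omega, hq⟩
        · right
          rw [show q - 2 + 1 + 1 = q by omega]
          exact ⟨by omega, hq⟩
      have hi : F.HasVar (i + 1) := by
        obtain ⟨q, hq⟩ : ∃ q, F.HasVar (q + 1) := by simpa [Closed, HasVar] using hnc
        rcases hvar _ hq with h0 | h0
        · omega
        · rwa [← h0]
      have hsub0 : F.subRank 0 + 1 ≤ (eps F).subRank i := by simp [subRank, hi]
      refine max_le ((Nat.succ_le_succ
        (subRank_inst_num_le n F _ _ (Nat.succ_pos _))).trans hsub0)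
        ((rank_inst_num_le n F _).trans ?_)
      rcases rank_eq_zero_or_le_subRank F hF with h0 | ⟨q, hq, hle⟩
      · omega
      · rcases hvar q hq with rfl | rfl
        · omega
        · exact hle.trans hsub
  | neg A ih => intro i t ht; exact ih h i t ht
  | conn c A B ihA ihB =>
    intro i t ht
    replace h : A.closedEps = ∅ ∧ B.closedEps = ∅ := by
      simp only [Finset.eq_empty_iff_forall_notMem, mem_closedEps_conn, not_or] at h ⊢
      exact ⟨fun u => (h u).1, fun u => (h u).2⟩
    exact (mem_closedEps_conn.1 ht).elim (fun ht => (ihA h.1 i t ht).trans (le_max_left _ _))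
      (fun ht => (ihB h.2 i t ht).trans (le_max_right _ _))

/-- The truth value of `G[n]`, for `εx. G` canonical, depends only on the substitution on terms of
rank less than that of `εx. G`. -/
theorem reduce_inst_num_congr {s s' : Exp L .term → ℕ} {G : Exp L .formula}
    (hG : G.closedEps = ∅) (hs : ∀ f : Exp L .term, f.rank < (eps G).rank → s f = s' f) (n : ℕ) :
    reduce s (inst (num n) G 0) = reduce s' (inst (num n) G 0) := by
  refine reduce_congr_of_rank_le (r := G.subRank 0) (fun f hf => hs f ?_) _
    (rank_le_subRank_of_mem_closedEps_inst n G hG 0)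
  exact lt_of_lt_of_le (Nat.lt_succ_of_le hf) (le_max_left _ _)

end Exp

variable {L : ArithLang}

/-! ### Corrections -/

open Classical in
theorem EpsSub.correct_val (S : EpsSub L) (A : EpsAxiom L) (f : Exp L .term) :
    (S.correct A).val f = if f = A.term S then S.value A.t
      else if f.rank ≤ (A.term S).rank then S.val f else 0 := by
  by_cases h : f ∈ S.dom
  · simp [EpsSub.correct, h]
  · simp [EpsSub.correct, h, S.val_eq_zero f h]

theorem EpsSub.correct_val_term (S : EpsSub L) (A : EpsAxiom L) :
    (S.correct A).val (A.term S) = S.value A.t := by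
  rw [S.correct_val, if_pos rfl]

theorem EpsSub.correct_val_of_ne (S : EpsSub L) (A : EpsAxiom L) {f : Exp L .term}
    (hf : f ≠ A.term S) (hr : f.rank ≤ (A.term S).rank) : (S.correct A).val f = S.val f := by
  rw [S.correct_val, if_neg hf, if_pos hr]

theorem EpsSub.correct_val_of_rank_lt (S : EpsSub L) (A : EpsAxiom L) {f : Exp L .term}
    (hr : f.rank < (A.term S).rank) : (S.correct A).val f = S.val f :=
  S.correct_val_of_ne A (fun h => by rw [h] at hr; exact lt_irrefl _ hr) hr.le

theorem EpsSub.mem_correct_dom (S : EpsSub L) (A : EpsAxiom L) (f : Exp L .term) :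
    f ∈ (S.correct A).dom ↔ f = A.term S ∨ f ∈ S.dom ∧ f.rank ≤ (A.term S).rank := by
  by_cases h : f = A.term S
  · simp [EpsSub.correct, h]
  · simp [EpsSub.correct, h, le_iff_lt_or_eq]

theorem EpsSub.rank_correct (S : EpsSub L) (A : EpsAxiom L) :
    (S.correct A).rank = (A.term S).rank := by
  refine le_antisymm (Finset.sup_le fun f hf => ?_)
    (Finset.le_sup (f := fun e : Exp L .term => e.rank) ((S.mem_correct_dom A _).2 (.inl rfl)))
  rcases (S.mem_correct_dom A f).1 hf with rfl | h
  · exact le_rfl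
  · exact h.2

theorem EpsSub.val_eq_zero_of_rank_lt (S : EpsSub L) {f : Exp L .term} (h : S.rank < f.rank) :
    S.val f = 0 :=
  S.val_eq_zero f fun hf =>
    absurd (Finset.le_sup (f := fun e : Exp L .term => e.rank) hf) (not_le.2 h)

theorem EpsSub.value_eps (S : EpsSub L) {F : Exp L .formula} (h : (Exp.eps F).Closed) :
    S.value (.eps F) = S.val (.eps (F.reduce S.val)) := by
  rw [EpsSub.value, Exp.reduce_eps_of_closed _ h, Exp.toNat]

theorem EpsSub.reduce_eq_of_value_eq {S T : EpsSub L} {κ : Kind} {e : Exp L κ}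
    (h : ∀ t ∈ e.closedEps, S.value t = T.value t) : e.reduce S.val = e.reduce T.val := by
  refine Exp.reduce_congr e fun t ht => ?_
  obtain ⟨G, rfl, hG⟩ := Exp.exists_eps_of_mem_closedEps ht
  rw [Exp.reduce_term S.val hG, Exp.reduce_term T.val hG]
  exact congrArg Exp.num (h _ ht)

/-! ### Epsilon axioms -/

theorem EpsAxiom.closedEps_t_subset (A : EpsAxiom L) : A.t.closedEps ⊆ A.formula.closedEps := by
  intro u hu
  exact Exp.mem_closedEps_conn.2 (.inr (Exp.mem_closedEps_conn.2 (.inl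
    (Exp.mem_closedEps_rel.2 ⟨0, hu⟩))))

theorem EpsAxiom.closedEps_eps_subset (A : EpsAxiom L) :
    (Exp.eps A.F).closedEps ⊆ A.formula.closedEps := by
  intro u hu
  exact Exp.mem_closedEps_conn.2 (.inr (Exp.mem_closedEps_conn.2 (.inl
    (Exp.mem_closedEps_rel.2 ⟨1, hu⟩))))

theorem EpsAxiom.rank_eps_le (A : EpsAxiom L) : (Exp.eps A.F).rank ≤ A.formula.rank := by
  have h1 : (Exp.eps A.F).rank ≤ (Exp.rel L.lt ![A.t, .eps A.F]).rank :=
    Finset.le_sup (f := fun j => ((![A.t, .eps A.F] : Fin 2 → Exp L .term) j).rank)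
      (Finset.mem_univ 1)
  exact h1.trans ((le_max_left _ _).trans (le_max_right _ _))

/-- `G[n]` is true under `s`. -/
def Holds (s : Exp L .term → ℕ) (G : Exp L .formula) (n : ℕ) : Prop :=
  (Exp.inst (.num n) G 0).reduce s = .truth true

theorem holds_congr {s s' : Exp L .term → ℕ} {G : Exp L .formula}
    (hG : G.closedEps = ∅) (hs : ∀ f : Exp L .term, f.rank < (Exp.eps G).rank → s f = s' f)
    (n : ℕ) : Holds s G n ↔ Holds s' G n := by
  rw [Holds, Holds, Exp.reduce_inst_num_congr hG hs]

/-- By `reduce_inst` the terms `t` and `εx. F` may be replaced by their values and `F` by its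
irreducible form, which turns the axiom into a statement about numbers. -/
theorem EpsAxiom.validates_of (A : EpsAxiom L) (S : EpsSub L)
    (h : Holds S.val (A.F.reduce S.val) (S.value A.t) →
      ¬ S.value A.t < S.val (A.term S) ∧ Holds S.val (A.F.reduce S.val) (S.val (A.term S))) :
    S.Validates A.formula := by
  have h1 : (Exp.inst A.t A.F 0).reduce S.val
      = (Exp.inst (.num (S.value A.t)) (A.F.reduce S.val) 0).reduce S.val :=
    Exp.reduce_inst S.val A.closed_t A.F 0
  have h2 : (Exp.inst (.eps A.F) A.F 0).reduce S.val
      = (Exp.inst (.num (S.val (A.term S))) (A.F.reduce S.val) 0).reduce S.val := by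
    rw [Exp.reduce_inst S.val A.closed_eps A.F 0, Exp.reduce_eps_of_closed _ A.closed_eps,
      Exp.toNat]
    rfl
  have h3 : (Exp.rel L.lt ![A.t, .eps A.F]).reduce S.val
      = .truth (decide (S.value A.t < S.val (A.term S))) := by
    have hv : ∀ j : Fin 2, ((![A.t, .eps A.F] : Fin 2 → Exp L .term) j).reduce S.val
        = .num (![S.value A.t, S.val (A.term S)] j) := by
      intro j
      fin_cases j
      · exact Exp.reduce_term S.val A.closed_t
      · exact Exp.reduce_eps_of_closed S.val A.closed_eps
    rw [Exp.reduce_rel]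
    simp only [hv]
    rw [Exp.evalRel, if_pos fun j => ⟨_, rfl⟩, L.lt_val]
    rfl
  have h4 := Exp.reduce_formula S.val (Exp.closed_inst A.closed_t A.closed_eps)
  have h5 := Exp.reduce_formula S.val (Exp.closed_inst A.closed_eps A.closed_eps)
  rw [Holds, Holds, ← h1, ← h2] at h
  generalize ((Exp.inst A.t A.F 0).reduce S.val).toBool = p at h4
  generalize ((Exp.inst (.eps A.F) A.F 0).reduce S.val).toBool = q at h5
  rw [h4, h5] at h
  rw [EpsSub.Validates, EpsAxiom.formula, Exp.reduce_conn, Exp.reduce_conn, Exp.reduce_neg, h3, h4,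
    h5]
  have hn (b : Bool) : Exp.evalNeg (.truth b : Exp L .formula) = .truth (!b) := by
    rw [Exp.evalNeg, if_pos ⟨b, rfl⟩]; rfl
  have hc (c : Conn) (b b' : Bool) :
      Exp.evalConn c (.truth b : Exp L .formula) (.truth b') = .truth (c.val b b') := by
    rw [Exp.evalConn, if_pos ⟨⟨b, rfl⟩, ⟨b', rfl⟩⟩]; rfl
  rw [hn, hc, hc]
  cases p
  · rfl
  · obtain ⟨h6, h7⟩ := h rfl
    have : q = true := by simpa using h7
    simp [this, h6, Conn.val]

/-! ### The witness invariant of corrections -/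

/-- The values of the substitution are witnesses, and the default value is not. -/
def EpsSub.Correct (S : EpsSub L) : Prop :=
  ∀ G, Exp.eps G ∈ S.dom → Holds S.val G (S.val (.eps G)) ∧ ¬ Holds S.val G 0

/-- If the corrected term is in the domain, its value is a witness, so only minimality can fail. If
not, its value is `0`, minimality is trivial, and `F[0]` must be false. -/
theorem EpsSub.Correct.of_not_validates {S : EpsSub L} (hS : S.Correct) {A : EpsAxiom L}
    (hA : ¬ S.Validates A.formula) :
    Holds S.val (A.F.reduce S.val) (S.value A.t) ∧ ¬ Holds S.val (A.F.reduce S.val) 0 ∧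
      (S.val (A.term S) = 0 ∨ S.value A.t < S.val (A.term S)) := by
  have h := mt (A.validates_of S) hA
  push Not at h
  obtain ⟨h1, h2⟩ := h
  refine ⟨h1, ?_⟩
  by_cases hd : A.term S ∈ S.dom
  · obtain ⟨h3, h4⟩ := hS _ hd
    refine ⟨h4, .inr ?_⟩
    by_contra! hlt
    exact h2 hlt h3
  · have h0 := S.val_eq_zero _ hd
    rw [h0] at h2 ⊢
    exact ⟨h2 (Nat.zero_le _), .inl rfl⟩

theorem EpsSub.Correct.ackNorm_lt {S : EpsSub L} (hS : S.Correct) {A : EpsAxiom L}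
    (hA : ¬ S.Validates A.formula) : ackNorm (S.value A.t) < ackNorm (S.val (A.term S)) := by
  obtain ⟨h1, h2, h3⟩ := hS.of_not_validates hA
  exact ackNorm_lt_of_lt (fun h => h2 (h ▸ h1)) h3

/-- Truth of `G[n]` depends only on entries of rank below that of `εx. G` (`holds_congr`). Every
surviving entry has rank at most that of the corrected term, and nothing below that rank has
changed. -/
theorem EpsSub.Correct.correct {S : EpsSub L} (hS : S.Correct) {A : EpsAxiom L}
    (hA : ¬ S.Validates A.formula) : (S.correct A).Correct := by
  intro G hG
  obtain ⟨G', hG', -, hcl⟩ := (S.correct A).canonical _ hG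
  obtain rfl : G = G' := by simpa using hG'
  by_cases he : Exp.eps G = A.term S
  · obtain rfl : G = A.F.reduce S.val := by simpa [EpsAxiom.term] using he
    have hc := holds_congr (s := (S.correct A).val) (s' := S.val) hcl
      fun f hf => S.correct_val_of_rank_lt A hf
    rw [hc, hc, he, S.correct_val_term]
    obtain ⟨h1, h2, -⟩ := hS.of_not_validates hA
    exact ⟨h1, h2⟩
  · obtain ⟨hd, hr⟩ := ((S.mem_correct_dom A _).1 hG).resolve_left he
    have hc := holds_congr (s := (S.correct A).val) (s' := S.val) hcl
      fun f hf => S.correct_val_of_rank_lt A (hf.trans_le hr)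
    rw [hc, hc, S.correct_val_of_ne A he hr]
    exact hS G hd

/-! ### The H-process -/

section Corrections

variable {Cr : List (EpsAxiom L)}

theorem subset_closedTerms {A : EpsAxiom L} (hA : A ∈ Cr) :
    A.formula.closedEps ⊆ closedTerms Cr := by
  classical
  intro u hu
  exact Finset.mem_biUnion.2 ⟨A, List.mem_toFinset.2 hA, hu⟩

theorem closedEps_subset_closedTerms {t : Exp L .term} (ht : t ∈ closedTerms Cr) :
    t.closedEps ⊆ closedTerms Cr := by
  classical
  obtain ⟨A, hA, h⟩ := Finset.mem_biUnion.1 ht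
  exact (Exp.closedEps_subset_of_mem h).trans (subset_closedTerms (List.mem_toFinset.1 hA))

theorem Solving.congr {S T : EpsSub L} (h : ∀ e ∈ closedTerms Cr, S.value e = T.value e)
    (hS : Solving Cr S) : Solving Cr T := by
  intro A hA
  rw [EpsSub.Validates, ← EpsSub.reduce_eq_of_value_eq fun t ht => h t (subset_closedTerms hA ht)]
  exact hS A hA

theorem exists_eps_of_mem_closedTerms {t : Exp L .term} (ht : t ∈ closedTerms Cr) :
    ∃ G, t = Exp.eps G ∧ (Exp.eps G).Closed := by
  classical
  obtain ⟨A, -, h⟩ := Finset.mem_biUnion.1 ht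
  exact Exp.exists_eps_of_mem_closedEps h

/-! ### Decrease of the index -/

theorem ind_congr (E : Arrangement Cr) {S T : EpsSub L}
    (h : ∀ e ∈ closedTerms Cr, S.value e = T.value e) : ind E S = ind E T := by
  have : ∀ i, S.value (E.equiv i) = T.value (E.equiv i) := fun i => h _ (E.equiv i).2
  simp only [ind, this]

theorem ind_summand_le (E : Arrangement Cr) (S : EpsSub L) (i : ℕ) :
    (if h : i < (closedTerms Cr).card then ackNorm (S.value (E.equiv ⟨i, h⟩)) else 0) ≤ ω := by
  split_ifs
  · exact ackNorm_le _
  · exact zero_le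

open Classical in
/-- The index decreases when a single value is improved and this is noticed by `Cr`. -/
theorem ind_lt_of_update (E : Arrangement Cr) {S T : EpsSub L} {e : Exp L .term} {v : ℕ}
    (hT : ∀ f, T.val f = if f = e then v else S.val f) (hv : ackNorm v < ackNorm (S.val e))
    (hne : ∃ t ∈ closedTerms Cr, T.value t ≠ S.value t) : ind E T < ind E S := by
  obtain ⟨t, ht, hne⟩ := hne
  have hnonempty : (Finset.univ.filter fun i => T.value (E.equiv i) ≠ S.value (E.equiv i)).Nonempty :=
    ⟨E.equiv.symm ⟨t, ht⟩, by simpa using hne⟩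
  -- The most significant digit that changes. Proper closed subterms of `e_i` stand at higher places
  -- and keep their values, so `e_i` reduces to the same canonical term under both substitutions;
  -- since its value changes, that term is `e`.
  obtain ⟨i, hi, hmax⟩ := Finset.exists_max_image _ id hnonempty
  simp only [Finset.mem_filter, Finset.mem_univ, true_and, id] at hi hmax
  have heq : ∀ j, i < j → T.value (E.equiv j) = S.value (E.equiv j) := by
    intro j hij
    by_contra h
    exact absurd (hmax j h) (not_le.2 hij)
  obtain ⟨G, hG, hGc⟩ := exists_eps_of_mem_closedTerms (E.equiv i).2
  have hred : G.reduce T.val = G.reduce S.val := by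
    refine EpsSub.reduce_eq_of_value_eq fun u hu => ?_
    have hu' : u ∈ (E.equiv i : Exp L .term).closedEps := by
      rw [hG]; exact Exp.closedEps_subset_eps G hu
    have hucl := closedEps_subset_closedTerms (E.equiv i).2 hu'
    have hj : (E.equiv (E.equiv.symm ⟨u, hucl⟩) : Exp L .term) = u := by simp
    have := heq (E.equiv.symm ⟨u, hucl⟩) (E.lt_of_sub i _ (by rwa [hj])
      (by rw [hj, hG]; exact Exp.ne_eps_of_mem_closedEps hu))
    rwa [hj] at this
  have hlt : ackNorm (T.value (E.equiv i)) < ackNorm (S.value (E.equiv i)) := by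
    rw [hG, T.value_eps hGc, S.value_eps hGc, hred, hT] at hi ⊢
    split_ifs at hi ⊢ with h
    · rwa [h]
    · exact absurd rfl hi
  refine expansion_lt_expansion (ind_summand_le E T) i.2 ?_ fun j hij hj => ?_
  · simpa using hlt
  · simp only [dif_pos hj]
    rw [heq ⟨j, hj⟩ hij]

/-! ### The course of the process and its repetition -/

variable (σ : Selection Cr)

theorem hSeq_succ {n : ℕ} (h : ¬ Solving Cr (hSeq σ n)) :
    hSeq σ (n + 1) = (hSeq σ n).correct (σ.pick (hSeq σ n)) := by
  rw [hSeq, if_neg h]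

theorem not_solving_of_le (m n : ℕ) (hmn : m ≤ n) (h : ¬ Solving Cr (hSeq σ n)) :
    ¬ Solving Cr (hSeq σ m) := by
  intro hm
  have : ∀ k, hSeq σ (m + k) = hSeq σ m := by
    intro k
    induction k with
    | zero => rfl
    | succ k ih => rw [← add_assoc, hSeq, ih, if_pos hm]
  obtain ⟨k, rfl⟩ := Nat.exists_eq_add_of_le hmn
  exact h (by rwa [this])

theorem hSeq_correct (n : ℕ) : (hSeq σ n).Correct := by
  induction n with
  | zero =>
    intro G hG
    simp [hSeq, EpsSub.empty] at hG
  | succ n ih =>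
    by_cases h : Solving Cr (hSeq σ n)
    · rwa [hSeq, if_pos h]
    · rw [hSeq_succ σ h]
      exact ih.correct (σ.pick_false _ h)

theorem rnk_succ {n : ℕ} (h : ¬ Solving Cr (hSeq σ (n + 1))) :
    rnk σ (n + 1) = ((σ.pick (hSeq σ n)).term (hSeq σ n)).rank := by
  rw [rnk, if_neg h, hSeq_succ σ (not_solving_of_le σ n (n + 1) (Nat.le_succ n) h),
    EpsSub.rank_correct]

theorem rnk_lt_RANK (n : ℕ) : rnk σ n < RANK Cr := by
  classical
  have hpos : 0 < RANK Cr := lt_of_lt_of_le two_pos (le_max_right _ _)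
  by_cases h : Solving Cr (hSeq σ n)
  · rwa [rnk, if_pos h]
  · rcases n with _ | n
    · rw [rnk, if_neg h]
      simpa [hSeq, EpsSub.empty, EpsSub.rank] using hpos
    · rw [rnk_succ σ h]
      have hn := not_solving_of_le σ n (n + 1) (Nat.le_succ n) h
      have h1 : ((σ.pick (hSeq σ n)).term (hSeq σ n)).rank ≤ (σ.pick (hSeq σ n)).formula.rank :=
        (Exp.rank_eps_reduce_le _ _).trans (EpsAxiom.rank_eps_le _)
      have h2 : (σ.pick (hSeq σ n)).formula.rank ≤
          Cr.toFinset.sup fun A => A.formula.rank :=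
        Finset.le_sup (f := fun A : EpsAxiom L => A.formula.rank)
          (List.mem_toFinset.2 (σ.pick_mem _ hn))
      have h3 : (Cr.toFinset.sup fun A => A.formula.rank) + 1 ≤ RANK Cr := by
        unfold RANK
        convert le_max_left _ _
      omega

theorem index_lt_epsilon_zero (E : Arrangement Cr) (n : ℕ) : index σ E n < ε₀ := by
  rw [index]
  split_ifs
  · exact Ordinal.epsilon_pos 0
  · exact expansion_lt_epsilon_zero (ind_summand_le E _) _

/-- Entries of low rank are kept as long as corrections have higher rank. -/
theorem hSeq_val_eq {x a r : ℕ} (hns : ¬ Solving Cr (hSeq σ (a - 1)))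
    (hr : ∀ i, x < i → i < a → r < rnk σ i) :
    ∀ i, x + i < a → ∀ f : Exp L .term, f.rank ≤ r → (hSeq σ (x + i)).val f = (hSeq σ x).val f := by
  intro i
  induction i with
  | zero => intro _ f _; rfl
  | succ i ih =>
    intro hi f hf
    have h1 : ¬ Solving Cr (hSeq σ (x + i + 1)) := not_solving_of_le σ _ _ (by omega) hns
    have h2 := hr (x + i + 1) (by omega) hi
    rw [rnk_succ σ h1] at h2
    rw [← add_assoc, hSeq_succ σ (not_solving_of_le σ _ _ (Nat.le_succ _) h1),
      EpsSub.correct_val_of_rank_lt _ _ (hf.trans_lt h2)]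
    exact ih (by omega) f hf

/-- After a correction of rank `r_a` the process repeats what it did after the last earlier place of
rank at most `r_a`, until the index becomes smaller. -/
theorem exists_dominates (E : Arrangement Cr) (x a b : ℕ) (hxa : x < a) (hab : a < b)
    (hns : ¬ Solving Cr (hSeq σ (b - 1))) (hx : rnk σ x ≤ rnk σ a)
    (hlast : ∀ i, x < i → i < a → rnk σ a < rnk σ i) : ∃ j, Dominates σ E x a a b j := by
  classical
  have hNS : ∀ n, n < b → ¬ Solving Cr (hSeq σ n) := fun n hn =>
    not_solving_of_le σ _ _ (by omega) hns
  obtain ⟨n, rfl⟩ : ∃ n, a = x + n + 1 := ⟨a - x - 1, by omega⟩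
  set S := hSeq σ (x + n) with hSdef
  set A := σ.pick S with hAdef
  have hSns : ¬ Solving Cr S := hNS _ (by omega)
  have hA : ¬ S.Validates A.formula := σ.pick_false S hSns
  set e := A.term S with hedef
  set v := S.value A.t with hvdef
  have hra : rnk σ (x + n + 1) = e.rank := rnk_succ σ (hNS _ hab)
  have hack : ackNorm v < ackNorm (S.val e) := (hSeq_correct σ _).ackNorm_lt hA
  have hlow : ∀ i, x + i < x + n + 1 → ∀ f : Exp L .term, f.rank ≤ e.rank →
      (hSeq σ (x + i)).val f = (hSeq σ x).val f :=
    hSeq_val_eq σ (hNS _ (by omega)) fun i h1 h2 => hra ▸ hlast i h1 h2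
  have hxrank : (hSeq σ x).rank ≤ e.rank := by
    rw [← hra]
    rwa [rnk, if_neg (hNS x (by omega))] at hx
  have hstart : ∀ f, (hSeq σ (x + n + 1)).val f = if f = e then v else (hSeq σ x).val f := by
    intro f
    rw [hSeq_succ σ hSns, EpsSub.correct_val]
    split_ifs with h1 h2
    · rfl
    · exact hlow n (by omega) f h2
    -- Above the rank of `e` the correction has deleted everything, and `hSeq σ x` had no entries
    -- there because of `hx`.
    · exact (EpsSub.val_eq_zero_of_rank_lt _ (hxrank.trans_lt (not_le.1 h2))).symm
  -- the two stretches proceed alike as long as all closed terms of `Cr` have the same values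
  set Agree : ℕ → Prop := fun i =>
    ∀ t ∈ closedTerms Cr, (hSeq σ (x + n + 1 + i)).value t = (hSeq σ (x + i)).value t with hAgree
  have hstep : ∀ i, i < n → Agree i →
      (∀ f, (hSeq σ (x + n + 1 + i)).val f = if f = e then v else (hSeq σ (x + i)).val f) →
      (hSeq σ (x + n + 1 + (i + 1))).rank = (hSeq σ (x + (i + 1))).rank ∧
      ∀ f, (hSeq σ (x + n + 1 + (i + 1))).val f =
        if f = e then v else (hSeq σ (x + (i + 1))).val f := by
    intro i hi hag hval
    have hn1 : ¬ Solving Cr (hSeq σ (x + i)) := hNS _ (by omega)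
    have hn2 : ¬ Solving Cr (hSeq σ (x + n + 1 + i)) := fun h => hn1 (h.congr hag)
    have hpick := σ.pick_congr _ _ hn2 hn1 hag
    have hmem := σ.pick_mem _ hn1
    have hterm : (σ.pick (hSeq σ (x + i))).term (hSeq σ (x + n + 1 + i)) =
        (σ.pick (hSeq σ (x + i))).term (hSeq σ (x + i)) := by
      rw [EpsAxiom.term, EpsAxiom.term, EpsSub.reduce_eq_of_value_eq fun t ht => hag t
        (subset_closedTerms hmem (EpsAxiom.closedEps_eps_subset _ (Exp.closedEps_subset_eps _ ht)))]
    have hvalue : (hSeq σ (x + n + 1 + i)).value (σ.pick (hSeq σ (x + i))).t =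
        (hSeq σ (x + i)).value (σ.pick (hSeq σ (x + i))).t := by
      rw [EpsSub.value, EpsSub.value, EpsSub.reduce_eq_of_value_eq fun t ht => hag t
        (subset_closedTerms hmem (EpsAxiom.closedEps_t_subset _ ht))]
    -- The common correction has rank above that of `e`, so the entry of `e` survives it in both
    -- stretches.
    have hrk := hlast (x + i + 1) (by omega) (by omega)
    rw [rnk_succ σ (hNS (x + i + 1) (by omega)), hra] at hrk
    rw [← add_assoc, ← add_assoc, hSeq_succ σ hn1, hSeq_succ σ hn2, hpick, EpsSub.rank_correct,
      EpsSub.rank_correct, hterm]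
    refine ⟨rfl, fun f => ?_⟩
    rw [EpsSub.correct_val, EpsSub.correct_val, hterm, hvalue, hval]
    by_cases hfe : f = e
    · have hne : f ≠ (σ.pick (hSeq σ (x + i))).term (hSeq σ (x + i)) := by
        intro h
        rw [← h, hfe] at hrk
        exact lt_irrefl _ hrk
      rw [if_neg hne, if_pos hfe, if_pos hfe, if_pos (by rw [hfe]; exact hrk.le)]
    · rw [if_neg hfe, if_neg hfe]
  have hrun : ∀ i, i ≤ n → (∀ q, q < i → Agree q) →
      ∀ f, (hSeq σ (x + n + 1 + i)).val f = if f = e then v else (hSeq σ (x + i)).val f := by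
    intro i
    induction i with
    | zero => intro _ _; exact hstart
    | succ i ih =>
      intro hi hag
      exact (hstep i (by omega) (hag i (Nat.lt_succ_self i))
        (ih (by omega) fun q hq => hag q (by omega))).2
  have hex : ∃ j, j ≤ n ∧ ¬ Agree j := by
    by_contra! hall
    have hval := hrun n le_rfl fun q hq => hall q hq.le
    have hag := hall n le_rfl
    have hmem := σ.pick_mem S hSns
    have h1 := hag (.eps A.F) (subset_closedTerms hmem
      (A.closedEps_eps_subset (Exp.eps_mem_closedEps A.closed_eps)))
    rw [EpsSub.value_eps _ A.closed_eps, EpsSub.value_eps _ A.closed_eps,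
      EpsSub.reduce_eq_of_value_eq fun t ht => hag t (subset_closedTerms hmem
        (A.closedEps_eps_subset (Exp.closedEps_subset_eps _ ht))), hval] at h1
    change (if e = e then v else S.val e) = S.val e at h1
    rw [if_pos rfl] at h1
    rw [h1] at hack
    exact lt_irrefl _ hack
  obtain ⟨hjn, hj⟩ := Nat.find_spec hex
  have hbefore : ∀ q, q < Nat.find hex → Agree q := by
    intro q hq
    by_contra h
    exact Nat.find_min hex hq ⟨by omega, h⟩
  refine ⟨Nat.find hex, by omega, hab, fun i h1 h2 h3 => ?_, fun i h1 h2 => ?_, fun h => ?_⟩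
  · obtain ⟨i, rfl⟩ := Nat.exists_eq_succ_of_ne_zero h1.ne'
    rw [rnk, rnk, if_neg (hNS _ h3), if_neg (hNS _ (by omega))]
    exact (hstep i (by omega) (hbefore i (by omega))
      (hrun i (by omega) fun q hq => hbefore q (by omega))).1
  · rw [index, index, if_neg (hNS _ h2), if_neg (hNS _ (by omega)), ind_congr E (hbefore i h1)]
  · rw [index, index, if_neg (hNS _ h), if_neg (hNS _ (by omega))]
    refine ind_lt_of_update E (hrun _ hjn hbefore) ?_ (by simpa [Agree] using hj)
    rw [hlow _ (by omega) e le_rfl, ← hlow n (by omega) e le_rfl]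
    exact hack

/-- Minimality of the first rank is the form in which being a $p$-series enters the comparison. -/
theorem IsSeries.lt_and_rnk_le {p m k : ℕ} (h : IsSeries σ p m k) :
    m < k ∧ ∀ i, m < i → i < k → rnk σ m ≤ rnk σ i := by
  have h' : m < k ∧ rnk σ m ≤ seriesRank σ m k := by
    cases p with
    | zero => exact ⟨h.1, h.2.1⟩
    | succ p => exact ⟨h.1, h.2.1⟩
  exact ⟨h'.1, fun i h1 h2 => h'.2.trans
    (Nat.sInf_le (Set.mem_insert_of_mem _ (Set.mem_image_of_mem _ ⟨h1, h2⟩)))⟩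

end Corrections

end EpsPA

theorem mainTheorem4 (L : EpsPA.ArithLang) (Cr : List (EpsPA.EpsAxiom L))
    (σ : EpsPA.Selection Cr) (E : EpsPA.Arrangement Cr) (p m₀ k₀ m₁ k₁ : ℕ)
    (h₀ : EpsPA.IsSeries σ p m₀ k₀) (h₁ : EpsPA.IsSeries σ p m₁ k₁)
    (hconsec : k₀ = m₁)
    (hnonsolving : ¬ EpsPA.Solving Cr (EpsPA.hSeq σ (k₁ - 1)))
    (hrank : EpsPA.rnk σ m₀ ≤ EpsPA.rnk σ m₁) :
    EpsPA.seriesOrd σ E 0 m₁ k₁ < EpsPA.seriesOrd σ E 0 m₀ k₀ ∧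
      EpsPA.seriesOrd σ E 0 m₀ k₀ < ε₀ := by
  subst hconsec
  have hlt₀ := h₀.lt_and_rnk_le.1
  obtain ⟨hlt₁, hle₁⟩ := h₁.lt_and_rnk_le
  -- For $\xi=0$ the level is `RANK Cr`, and the lower bounds on the ranks become `0`.
  refine ⟨EpsPA.seriesOrdAux_lt_of_consecutive (EpsPA.rnk_lt_RANK σ)
    (EpsPA.not_solving_of_le σ) (EpsPA.exists_dominates σ E) _ m₀ k₀ k₁ hlt₀ hlt₁ hnonsolving hrank
    hle₁ (fun i _ _ => by simp) (fun i _ _ => by simp), ?_⟩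
  exact EpsPA.seriesOrdAux_lt_epsilon_zero σ E (EpsPA.index_lt_epsilon_zero σ E) _ _ _
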